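/- **Conventions.** Let $G$ be a countable group with an enumeration $(\gamma_i)_{i\ge 1}$ of its elements (possibly with repetitions). For a finite set $A$, equip $A^G$ with the metric $r(t_1,t_2)=\sup_i \frac1i d(t_1(\gamma_i),t_2(\gamma_i))$, where $d$ is the discrete metric on $A$, and the Borel probability measures on $A^G$ with the Kantorovich distance $l(\mu_1,\mu_2)=\inf_\xi\int r\,d\xi$, where $\xi$ ranges over the couplings of $\mu_1$ and $\mu_2$; limits of measures on $A^G$ are taken with respect to $l$. All actions are measure preserving actions of $G$ on standard probability spaces. An *observable* is a measurable map $f:X\to A$ to a finite set $A$; put $f^G:X\to A^G$, $f^G(x)(g)=f(gx)$, and $\mathrm{distr}(f)=f^G_*\mu$. A *sofic approximation* $\mathfrak S=((V_i),(\sigma_i))$ of $G$ consists of finite nonempty sets $V_i$ and maps $\sigma_i:G\to\mathrm{Sym}(V_i)$, $g\mapsto\sigma_i^g$, such that, for the normalised Hamming distance $d_H$, $d_H(\sigma_i^{g_1},\sigma_i^{g_2})\to1$ for all $g_1\ne g_2$ and $d_H(\sigma_i^{g_1}\sigma_i^{g_2},\sigma_i^{g_1g_2})\to0$ for all $g_1,g_2\in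 G$. The group $G$ is *sofic* if it has a sofic approximation. For $\sigma:G\to\mathrm{Sym}(V)$ and a probability measure $\eta$ on $A^V$, let $\Theta_\sigma(\eta)=\frac1{|V|}\sum_{v\in V}(\theta_{v,\sigma})_*\eta$, where $\theta_{v,\sigma}(\tau)(g)=\tau(\sigma^g(v))$; write $\Theta$ for $\Theta_{\sigma_i}$ when $V=V_i$. An action on $(X,\mu)$ is *$\mathfrak S$-approximable* if for every observable $f:X\to A$ there are $\tau_i\in A^{V_i}$ with $\lim_{i\to\infty}\Theta(\delta_{\tau_i})=\mathrm{distr}(f)$; it is *$\mathfrak S$-weakly approximable* if for every observable $f:X\to A$ there are $i_1<i_2<\dots$ and $\tau_j\in A^{V_{i_j}}$ with $\lim_{j\to\infty}\Theta(\delta_{\tau_j})=\mathrm{distr}(f)$. An action is *sofic* if it is $\mathfrak S'$-weakly approximable for some sofic approximation $\mathfrak S'$ of $G$. An action on $(X_1,\mu_1)$ is *weakly contained* in an action on $(X_2,\mu_2)$ if for every observable $f_1:X_1\to A$ and every $\varepsilon>0$ there is an observable $f_2:X_2\to A$ with $l(\mathrm{distr}(f_2),\mathrm{distr}(f_1))<\varepsilon$.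 A *universal sofic action* is a sofic action in which every sofic action of $G$ is weakly contained, and $\mathfrak S$ is *maximal* if every universal sofic action of $G$ is $\mathfrak S$-approximable. An action on $(X,\mu)$ is *strongly sofic with respect to $\mathfrak S$* (admits doubly-quenched approximations) if for every observable $f:X\to A$ there are probability measures $\eta_i$ on $A^{V_i}$ such that $$\lim_{i\to\infty}\Theta(\eta_i\otimes\eta_i)=\mathrm{distr}(f)\otimes\mathrm{distr}(f)$$ and, for every $\varepsilon>0$, $$\lim_{i\to\infty}(\eta_i\otimes\eta_i)\big(\{\xi\in(A\times A)^{V_i} : l(\Theta(\delta_\xi),\mathrm{distr}(f)\otimes\mathrm{distr}(f))<\varepsilon\}\big)=1,$$ where $A^{I}\times A^{I}$ is identified with $(A\times A)^{I}$ for $I=V_i$ and $I=G$. **Theorem.** Let $\mathfrak S$ be a maximal sofic approximation of a sofic group $G$. Then every sofic action of $G$ on a standard probability space is strongly sofic with respect to $\mathfrak S$. -/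

import Mathlib

open MeasureTheory Filter Topology
open scoped ENNReal

namespace SoficAction

/-! ### Distances -/

section Distances

open Classical in
/-- The discrete metric: `0` on the diagonal and `1` off it. -/
noncomputable def discreteDist {A : Type*} (a b : A) : ℝ≥0∞ := if a = b then 0 else 1

/-- The metric on `A ^ G` for a finite set `A` with the discrete metric:
`sup_i d (t₁ (γ i), t₂ (γ i)) / i`, where `γ` enumerates `G`. The enumeration is indexed from `0`
here, hence the weight `1 / (i + 1)`; it may have repetitions, so finite groups are covered. -/
noncomputable def shiftDist {G A : Type*} (γ : ℕ → G) (t₁ t₂ : G → A) : ℝ≥0∞ :=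
  ⨆ i : ℕ, discreteDist (t₁ (γ i)) (t₂ (γ i)) / ((i : ℝ≥0∞) + 1)

/-- The Kantorovich distance of two measures with respect to the metric `r`: the infimum of
`∫ r dξ` over all couplings `ξ`. -/
noncomputable def kantorovich {X : Type*} [MeasurableSpace X] (r : X → X → ℝ≥0∞)
    (μ₁ μ₂ : Measure X) : ℝ≥0∞ :=
  ⨅ (ξ : Measure (X × X)) (_ : ξ.map Prod.fst = μ₁ ∧ ξ.map Prod.snd = μ₂),
    ∫⁻ p, r p.1 p.2 ∂ξ

/-- The normalised Hamming distance on `Sym(V)`. -/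
noncomputable def permDist {V : Type*} [Fintype V] (p q : Equiv.Perm V) : ℝ :=
  (Set.ncard {v | p v ≠ q v} : ℝ) / (Fintype.card V : ℝ)

end Distances

/-! ### Sofic approximations -/

/-- A sofic approximation of `G`: finite (nonempty) sets `V i` and maps `σ i : G → Sym(V i)` that
are asymptotically free and asymptotically multiplicative. -/
structure SoficApproximation (G : Type*) [Group G] where
  V : ℕ → Type
  [fintypeV : ∀ i, Fintype (V i)]
  [nonemptyV : ∀ i, Nonempty (V i)]
  σ : ∀ i, G → Equiv.Perm (V i)
  tendsto_free : ∀ g₁ g₂ : G, g₁ ≠ g₂ →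
    Tendsto (fun i => permDist (σ i g₁) (σ i g₂)) atTop (𝓝 1)
  tendsto_mul : ∀ g₁ g₂ : G,
    Tendsto (fun i => permDist (σ i g₁ * σ i g₂) (σ i (g₁ * g₂))) atTop (𝓝 0)

attribute [instance] SoficApproximation.fintypeV SoficApproximation.nonemptyV

section LocalStatistics

variable {G : Type*} {V : Type*} {A : Type*}

/-- The map `θ_{v,σ} : A ^ V → A ^ G`, `θ_{v,σ}(τ)(g) = τ(σ^g(v))`. -/
def pullbackName (σ : G → Equiv.Perm V) (v : V) (τ : V → A) : G → A :=
  fun g => τ (σ g v)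

/-- `Θ_σ(η) = |V|⁻¹ ∑_v θ_{v,σ}(η)`, the average over `v` of the push-forwards of `η`. -/
noncomputable def localStat [Fintype V] [MeasurableSpace A] (σ : G → Equiv.Perm V)
    (η : Measure (V → A)) : Measure (G → A) :=
  (Fintype.card V : ℝ≥0∞)⁻¹ • ∑ v, η.map (pullbackName σ v)

/-- The product `η ⊗ η`, seen as a measure on `(A × A) ^ I` under the identification
`A ^ I × A ^ I ≃ (A × A) ^ I`. -/
noncomputable def selfProd {I : Type*} [MeasurableSpace A] (η : Measure (I → A)) :
    Measure (I → A × A) :=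
  (η.prod η).map (fun p i => (p.1 i, p.2 i))

end LocalStatistics

/-! ### Actions

An action is a type `X` with a `MulAction G X` instance and a measure `μ`; in all quantifications
below `X` is a standard Borel space, `μ` is a probability measure and the action is by measurable
maps preserving `μ`. Finite sets `A` carry the discrete σ-algebra. -/

/-- The law `f^G(μ)` of `f^G : X → A ^ G`, `f^G(x)(g) = f(g x)`. -/
noncomputable def distr (G : Type*) {X A : Type*} [Group G] [MeasurableSpace X] [MulAction G X]
    [MeasurableSpace A] (μ : Measure X) (f : X → A) : Measure (G → A) :=
  μ.map (fun x g => f (g • x))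

section Properties

variable {G : Type*} [Group G] (γ : ℕ → G)

/-- The action on `(X₁, μ₁)` is weakly contained in the action on `(X₂, μ₂)`. -/
def WeaklyContained {X₁ X₂ : Type*} [MeasurableSpace X₁] [MeasurableSpace X₂] [MulAction G X₁]
    [MulAction G X₂] (μ₁ : Measure X₁) (μ₂ : Measure X₂) : Prop :=
  ∀ (A : Type) [Finite A] [MeasurableSpace A] [DiscreteMeasurableSpace A] (f₁ : X₁ → A),
    Measurable f₁ → ∀ ε : ℝ≥0∞, 0 < ε → ∃ f₂ : X₂ → A, Measurable f₂ ∧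
      kantorovich (shiftDist γ) (distr G μ₂ f₂) (distr G μ₁ f₁) < ε

variable {X : Type*} [MeasurableSpace X] [MulAction G X]

/-- `𝔖`-weak approximability: approximation along a subsequence depending on the observable. -/
def IsWeaklyApproximable (𝔖 : SoficApproximation G) (μ : Measure X) : Prop :=
  ∀ (A : Type) [Finite A] [MeasurableSpace A] [DiscreteMeasurableSpace A] (f : X → A),
    Measurable f → ∃ k : ℕ → ℕ, StrictMono k ∧ ∃ τ : ∀ j, 𝔖.V (k j) → A,
      Tendsto (fun j => kantorovich (shiftDist γ)
        (localStat (𝔖.σ (k j)) (Measure.dirac (τ j))) (distr G μ f)) atTop (𝓝 0)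

/-- `𝔖`-approximability: approximation along the whole sequence. -/
def IsApproximable (𝔖 : SoficApproximation G) (μ : Measure X) : Prop :=
  ∀ (A : Type) [Finite A] [MeasurableSpace A] [DiscreteMeasurableSpace A] (f : X → A),
    Measurable f → ∃ τ : ∀ i, 𝔖.V i → A,
      Tendsto (fun i => kantorovich (shiftDist γ)
        (localStat (𝔖.σ i) (Measure.dirac (τ i))) (distr G μ f)) atTop (𝓝 0)

/-- The action is sofic: weakly approximable for some sofic approximation of `G`. -/
def IsSofic (μ : Measure X) : Prop :=
  ∃ 𝔖 : SoficApproximation G, IsWeaklyApproximable γ 𝔖 μ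

/-- A universal sofic action: a sofic action that weakly contains every sofic action on a standard
probability space. (Every standard Borel space is isomorphic to one in `Type`, so nothing is lost by
letting `Y` range over `Type`.) -/
def IsUniversalSofic (μ : Measure X) : Prop :=
  IsSofic γ μ ∧
    ∀ (Y : Type) [MeasurableSpace Y] [StandardBorelSpace Y] [MulAction G Y]
      [MeasurableConstSMul G Y] (ν : Measure Y) [IsProbabilityMeasure ν]
      [SMulInvariantMeasure G Y ν], IsSofic γ ν → WeaklyContained γ ν μ

/-- A maximal sofic approximation: every universal sofic action is `𝔖`-approximable. -/
def SoficApproximation.IsMaximal (𝔖 : SoficApproximation G) : Prop :=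
  ∀ (Y : Type) [MeasurableSpace Y] [StandardBorelSpace Y] [MulAction G Y]
    [MeasurableConstSMul G Y] (ν : Measure Y) [IsProbabilityMeasure ν]
    [SMulInvariantMeasure G Y ν], IsUniversalSofic γ ν → IsApproximable γ 𝔖 ν

/-- `𝔖`-strong soficity: every observable has a doubly-quenched approximation. -/
def IsStronglySofic (𝔖 : SoficApproximation G) (μ : Measure X) : Prop :=
  ∀ (A : Type) [Finite A] [MeasurableSpace A] [DiscreteMeasurableSpace A] (f : X → A),
    Measurable f → ∃ η : ∀ i, Measure (𝔖.V i → A), (∀ i, IsProbabilityMeasure (η i)) ∧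
      Tendsto (fun i => kantorovich (shiftDist γ)
        (localStat (𝔖.σ i) (selfProd (η i))) (selfProd (distr G μ f))) atTop (𝓝 0) ∧
      ∀ ε : ℝ≥0∞, 0 < ε →
        Tendsto (fun i => selfProd (η i) {ξ : 𝔖.V i → A × A |
          kantorovich (shiftDist γ) (localStat (𝔖.σ i) (Measure.dirac ξ))
            (selfProd (distr G μ f)) < ε}) atTop (𝓝 1)

end Properties

end SoficAction

/-!
Convergence of probability measures on `A ^ G` in the Kantorovich distance is convergence of all
cylinder probabilities (`tendsto_profile_of_kantorovich`, `tendsto_kantorovich_of_profile`). The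
profiles of cylinder probabilities live in a countable product of lines, so that closures, dense
sequences and diagonal choices are available there.

*Every sofic action is approximable along a maximal sofic approximation.* Products of sofic
approximations show that independent joinings of finitely many sofic laws are sofic
(`IsSoficProfile.pi`). An observable of a countable product of actions is, up to small measure, a
function of finitely many coordinates, and sofic laws form a closed set, so a countable product of
sofic actions is sofic (`isSofic_infinitePi`); a single sofic approximation that serves all
observables is obtained by interleaving (`isSofic_of_forall_isSoficProfile`). Hence the product of
countably many sofic actions with a dense set of laws is a universal sofic action
(`exists_isUniversalSofic`). It is approximable along a maximal sofic approximation by definition,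
and approximability passes to everything that is weakly contained in it
(`SoficApproximation.IsMaximal.exists_tendsto_profile`).

*Powers give doubly-quenched approximations.* The power `X ^ ℕ` of a sofic action is sofic, so for
each `n` the observable `(f (x 0), …, f (x n))` is approximated by labellings, that is, by `n + 1`
labellings `τ 0, …, τ n` which pairwise approximate `distr f ⊗ distr f`. For the uniform
distribution `η` on these labellings, `η ⊗ η` is uniform on the pairs `(τ k, τ l)`, of which only a
fraction `1 / (n + 1)` has `k = l`. Letting `n` grow slowly with the index of the sofic
approximation gives the doubly-quenched approximation (`isStronglySofic_of_isMaximal`).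
-/

namespace SoficAction

/-! ### Cylinder probabilities -/

section Profile

variable {G A B : Type*}

/-- A pattern: a finite window in `G` together with a labelling of the window. -/
abbrev Pattern (G A : Type*) := Σ F : Finset G, (F → A)

/-- The set of configurations that show the pattern `c` on its window. -/
def patternSet (c : Pattern G A) : Set (G → A) := {t | ∀ g : c.1, t g = c.2 g}

/-- The family of all cylinder probabilities of a measure on `A ^ G`. For probability measures,
convergence in the Kantorovich distance is coordinatewise convergence of the profiles; the space of
profiles has the advantage of being a countable product of lines. -/
noncomputable def profile [MeasurableSpace A] (m : Measure (G → A)) : Pattern G A → ℝ :=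
  fun c => m.real (patternSet c)

/-! ### The Kantorovich distance and cylinder probabilities -/

lemma discreteDist_le_one (a b : A) : discreteDist a b ≤ 1 := by
  unfold discreteDist; split_ifs <;> simp

variable [MeasurableSpace A] [MeasurableSpace B]

lemma measurableSet_patternSet [DiscreteMeasurableSpace A] (c : Pattern G A) :
    MeasurableSet (patternSet c) := by
  have : patternSet c = ⋂ g : c.1, (fun t : G → A => t g) ⁻¹' {c.2 g} := by
    ext t; simp [patternSet]
  rw [this]
  exact MeasurableSet.iInter fun g => measurable_pi_apply _ (MeasurableSet.of_discrete)

/-- Kantorovich-close measures give a pattern almost the same probability. -/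
lemma measure_patternSet_le [Finite A] [DiscreteMeasurableSpace A] {γ : ℕ → G}
    (hγ : Function.Surjective γ) (c : Pattern G A) : ∃ K : ℝ≥0∞, K ≠ ∞ ∧ ∀ m₁ m₂ : Measure (G → A),
      m₁ (patternSet c) ≤ m₂ (patternSet c) + K * kantorovich (shiftDist γ) m₁ m₂ ∧
      m₂ (patternSet c) ≤ m₁ (patternSet c) + K * kantorovich (shiftDist γ) m₁ m₂ := by
  classical
  choose s hs using hγ
  obtain ⟨N, hN⟩ : ∃ N, ∀ g ∈ c.1, s g ≤ N :=
    ⟨c.1.sup s, fun g hg => Finset.le_sup (f := s) hg⟩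
  have hK : ((N : ℝ≥0∞) + 1) ≠ ∞ := by simp
  have hK0 : ((N : ℝ≥0∞) + 1) ≠ 0 := by simp
  -- a coupling charges the disagreements on the window by at most `(N + 1) ∫ r`
  have key : ∀ ξ : Measure ((G → A) × (G → A)),
      ξ {p | ∃ g ∈ c.1, p.1 g ≠ p.2 g} ≤ ((N : ℝ≥0∞) + 1) * ∫⁻ p, shiftDist γ p.1 p.2 ∂ξ := by
    intro ξ
    have hm : MeasurableSet {p : (G → A) × (G → A) | ∃ g ∈ c.1, p.1 g ≠ p.2 g} := by
      have : {p : (G → A) × (G → A) | ∃ g ∈ c.1, p.1 g ≠ p.2 g} =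
          ⋃ g ∈ c.1, {p : (G → A) × (G → A) | p.1 g = p.2 g}ᶜ := by ext; simp
      rw [this]
      refine MeasurableSet.biUnion c.1.countable_toSet fun g _ => (measurableSet_eq_fun ?_ ?_).compl
      · exact (measurable_pi_apply g).comp measurable_fst
      · exact (measurable_pi_apply g).comp measurable_snd
    calc ξ {p | ∃ g ∈ c.1, p.1 g ≠ p.2 g}
        = ((N : ℝ≥0∞) + 1) * (((N : ℝ≥0∞) + 1)⁻¹ * ξ {p | ∃ g ∈ c.1, p.1 g ≠ p.2 g}) := by
          rw [← mul_assoc, ENNReal.mul_inv_cancel hK0 hK, one_mul]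
      _ ≤ _ := by
          gcongr
          rw [← lintegral_indicator_const hm]
          refine lintegral_mono fun p => ?_
          refine Set.indicator_apply_le' (fun hp => ?_) fun _ => zero_le
          obtain ⟨g, hg, hne⟩ := hp
          refine le_trans ?_ (le_iSup _ (s g))
          rw [hs g, discreteDist, if_neg hne, one_div]
          gcongr
          exact hN g hg
  refine ⟨(N : ℝ≥0∞) + 1, hK, fun m₁ m₂ => ?_⟩
  have key2 : ∀ ξ : Measure ((G → A) × (G → A)), ξ.map Prod.fst = m₁ ∧ ξ.map Prod.snd = m₂ →
      m₁ (patternSet c) ≤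
        m₂ (patternSet c) + ((N : ℝ≥0∞) + 1) * ∫⁻ p, shiftDist γ p.1 p.2 ∂ξ ∧
      m₂ (patternSet c) ≤
        m₁ (patternSet c) + ((N : ℝ≥0∞) + 1) * ∫⁻ p, shiftDist γ p.1 p.2 ∂ξ := by
    rintro ξ ⟨rfl, rfl⟩
    rw [Measure.map_apply measurable_fst (measurableSet_patternSet c),
      Measure.map_apply measurable_snd (measurableSet_patternSet c)]
    constructor
    · refine (measure_mono (t := Prod.snd ⁻¹' patternSet c ∪
        {p : (G → A) × (G → A) | ∃ g ∈ c.1, p.1 g ≠ p.2 g})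
        fun p hp => ?_).trans ((measure_union_le _ _).trans (by gcongr; exact key ξ))
      by_cases h : ∃ g ∈ c.1, p.1 g ≠ p.2 g
      · exact Or.inr h
      · push Not at h
        exact Or.inl fun g => (h g g.2).symm.trans (hp g)
    · refine (measure_mono (t := Prod.fst ⁻¹' patternSet c ∪
        {p : (G → A) × (G → A) | ∃ g ∈ c.1, p.1 g ≠ p.2 g})
        fun p hp => ?_).trans ((measure_union_le _ _).trans (by gcongr; exact key ξ))
      by_cases h : ∃ g ∈ c.1, p.1 g ≠ p.2 g
      · exact Or.inr h
      · push Not at h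
        exact Or.inl fun g => (h g g.2).trans (hp g)
  have aux : ∀ a b : ℝ≥0∞, (∀ ξ : Measure ((G → A) × (G → A)),
      ξ.map Prod.fst = m₁ ∧ ξ.map Prod.snd = m₂ →
        a ≤ b + ((N : ℝ≥0∞) + 1) * ∫⁻ p, shiftDist γ p.1 p.2 ∂ξ) →
      a ≤ b + ((N : ℝ≥0∞) + 1) * kantorovich (shiftDist γ) m₁ m₂ := by
    intro a b h
    rw [← tsub_le_iff_left, mul_comm, ← ENNReal.div_le_iff hK0 hK]
    refine le_iInf₂ fun ξ hξ => ?_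
    rw [ENNReal.div_le_iff hK0 hK, mul_comm, tsub_le_iff_left]
    exact h ξ hξ
  exact ⟨aux _ _ fun ξ hξ => (key2 ξ hξ).1, aux _ _ fun ξ hξ => (key2 ξ hξ).2⟩

lemma tendsto_profile_of_kantorovich [Finite A] [DiscreteMeasurableSpace A] {γ : ℕ → G}
    (hγ : Function.Surjective γ) {ι : Type*} {l : Filter ι} {m : ι → Measure (G → A)}
    {m' : Measure (G → A)} [IsFiniteMeasure m']
    (h : Tendsto (fun i => kantorovich (shiftDist γ) (m i) m') l (𝓝 0)) :
    Tendsto (fun i => profile (m i)) l (𝓝 (profile m')) := by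
  refine tendsto_pi_nhds.2 fun c => ?_
  obtain ⟨K, hK, hle⟩ := measure_patternSet_le hγ c
  have h0 : Tendsto (fun i => K * kantorovich (shiftDist γ) (m i) m') l (𝓝 0) := by
    simpa using ENNReal.Tendsto.const_mul h (Or.inr hK)
  refine (ENNReal.tendsto_toReal (measure_ne_top m' _)).comp
    (tendsto_of_tendsto_of_tendsto_of_le_of_le
      (g := fun i => m' (patternSet c) - K * kantorovich (shiftDist γ) (m i) m')
      (h := fun i => m' (patternSet c) + K * kantorovich (shiftDist γ) (m i) m') ?_ ?_ ?_ ?_)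
  · simpa using ENNReal.Tendsto.sub tendsto_const_nhds h0 (Or.inl (measure_ne_top m' _))
  · simpa using tendsto_const_nhds.add h0
  · exact fun i => tsub_le_iff_right.2 (hle (m i) m').2
  · exact fun i => (hle (m i) m').1

/-- Two probability measures have a coupling under which the cells of a given finite partition
differ with probability at most the total variation distance of the two laws of the cell: couple
maximally the laws of the cell, and independently given the cells. -/
lemma exists_coupling_of_finite {Ω P : Type*} [MeasurableSpace Ω] [Fintype P] (q : Ω → P)
    (hq : ∀ p, MeasurableSet (q ⁻¹' {p})) (m₁ m₂ : Measure Ω) [IsProbabilityMeasure m₁]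
    [IsProbabilityMeasure m₂] : ∃ ξ : Measure (Ω × Ω), ξ.map Prod.fst = m₁ ∧ ξ.map Prod.snd = m₂ ∧
      ξ {z | q z.1 ≠ q z.2} ≤ ∑ p, (m₁ (q ⁻¹' {p}) - m₂ (q ⁻¹' {p})) := by
  classical
  set a : P → ℝ≥0∞ := fun p => m₁ (q ⁻¹' {p}) with ha
  set b : P → ℝ≥0∞ := fun p => m₂ (q ⁻¹' {p}) with hb
  set c₁ : P → Measure Ω := fun p => ProbabilityTheory.cond m₁ (q ⁻¹' {p}) with hc₁
  set c₂ : P → Measure Ω := fun p => ProbabilityTheory.cond m₂ (q ⁻¹' {p}) with hc₂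
  have hsum : ∀ m : Measure Ω, [IsProbabilityMeasure m] →
      ∑ p, m (q ⁻¹' {p}) • ProbabilityTheory.cond m (q ⁻¹' {p}) = m := by
    intro m _
    have h1 : ∀ p, m (q ⁻¹' {p}) • ProbabilityTheory.cond m (q ⁻¹' {p}) =
        m.restrict (q ⁻¹' {p}) := by
      intro p
      by_cases h : m (q ⁻¹' {p}) = 0
      · simp [h, Measure.restrict_eq_zero.2 h]
      · rw [ProbabilityTheory.cond, smul_smul, ENNReal.mul_inv_cancel h (measure_ne_top _ _),
          one_smul]
    simp_rw [h1]
    rw [← Measure.sum_fintype, ← Measure.restrict_iUnion _ hq]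
    · rw [show (⋃ p, q ⁻¹' {p}) = Set.univ by ext; simp, Measure.restrict_univ]
    · intro p p' hpp
      exact Disjoint.preimage q (by simpa using hpp)
  have hone : ∀ m : Measure Ω, [IsProbabilityMeasure m] → ∑ p, m (q ⁻¹' {p}) = 1 := by
    intro m _
    rw [← measure_biUnion_finset _ (fun p _ => hq p)]
    · simp [show (⋃ p, q ⁻¹' {p}) = Set.univ by ext; simp]
    · intro p _ p' _ hpp
      exact Disjoint.preimage q (by simpa using hpp)
  have hmass : ∀ (m : Measure Ω) [IsProbabilityMeasure m] (p : P) (x : ℝ≥0∞),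
      x ≤ m (q ⁻¹' {p}) → x * ProbabilityTheory.cond m (q ⁻¹' {p}) Set.univ = x := by
    intro m _ p x hx
    by_cases h : m (q ⁻¹' {p}) = 0
    · have : x = 0 := by simpa [h] using hx
      simp [this]
    · have := ProbabilityTheory.cond_isProbabilityMeasure h
      simp
  -- the mass `min (a p) (b p)` stays in the cell `p`; the excesses of the two laws have the same
  -- total mass `δ`, and are coupled independently
  set δ : ℝ≥0∞ := ∑ p, (a p - b p) with hδ
  have hwa : ∀ p, min (a p) (b p) + (a p - b p) = a p := fun p => by
    rcases le_total (a p) (b p) with h | h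
    · simp [min_eq_left h, tsub_eq_zero_of_le h]
    · simp [min_eq_right h, add_tsub_cancel_of_le h]
  have hwb : ∀ p, min (a p) (b p) + (b p - a p) = b p := fun p => by
    rcases le_total (a p) (b p) with h | h
    · simp [min_eq_left h, add_tsub_cancel_of_le h]
    · simp [min_eq_right h, tsub_eq_zero_of_le h]
  have hδ' : ∑ p, (b p - a p) = δ := by
    have e1 : ∑ p, min (a p) (b p) + ∑ p, (b p - a p) = 1 := by
      rw [← Finset.sum_add_distrib, Finset.sum_congr rfl fun p _ => hwb p]; exact hone m₂
    have e2 : ∑ p, min (a p) (b p) + δ = 1 := by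
      rw [hδ, ← Finset.sum_add_distrib, Finset.sum_congr rfl fun p _ => hwa p]; exact hone m₁
    have hf : ∑ p, min (a p) (b p) ≠ ∞ := fun h => by simp [h] at e2
    exact (ENNReal.add_right_inj hf).1 (e1.trans e2.symm)
  have hδtop : δ ≠ ∞ := by
    refine (lt_of_le_of_lt (Finset.sum_le_sum fun p _ => tsub_le_self) ?_).ne
    rw [hone m₁]; simp
  set ρ₁ : Measure Ω := ∑ p, (a p - b p) • c₁ p with hρ₁
  set ρ₂ : Measure Ω := ∑ p, (b p - a p) • c₂ p with hρ₂
  have hρ₁u : ρ₁ Set.univ = δ := by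
    simp only [hρ₁, Measure.coe_finsetSum, Finset.sum_apply, Measure.smul_apply, smul_eq_mul, hδ]
    exact Finset.sum_congr rfl fun p _ => hmass m₁ p _ tsub_le_self
  have hρ₂u : ρ₂ Set.univ = δ := by
    simp only [hρ₂, Measure.coe_finsetSum, Finset.sum_apply, Measure.smul_apply, smul_eq_mul,
      ← hδ']
    exact Finset.sum_congr rfl fun p _ => hmass m₂ p _ tsub_le_self
  have hfin₁ : IsFiniteMeasure ρ₁ := ⟨by rw [hρ₁u]; exact hδtop.lt_top⟩
  have hfin₂ : IsFiniteMeasure ρ₂ := ⟨by rw [hρ₂u]; exact hδtop.lt_top⟩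
  -- for `δ = 0` the factor `δ⁻¹ * δ` is `0`, but then `ρ` vanishes as well
  have hρ : ∀ ρ : Measure Ω, ρ Set.univ = δ → (δ⁻¹ * δ) • ρ = ρ := by
    intro ρ h
    by_cases h0 : δ = 0
    · rw [h0, Measure.measure_univ_eq_zero] at h
      simp [h]
    · rw [ENNReal.inv_mul_cancel h0 hδtop, one_smul]
  refine ⟨∑ p, min (a p) (b p) • (c₁ p).prod (c₂ p) + δ⁻¹ • ρ₁.prod ρ₂, ?_, ?_, ?_⟩
  · rw [Measure.map_add _ _ measurable_fst, Measure.map_smul, Measure.map_fst_prod, hρ₂u,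
      smul_smul, hρ ρ₁ hρ₁u, ← Measure.mapₗ_apply_of_measurable measurable_fst, map_sum, hρ₁,
      ← Finset.sum_add_distrib]
    refine (Finset.sum_congr rfl fun p _ => ?_).trans (hsum m₁)
    rw [Measure.mapₗ_apply_of_measurable measurable_fst, Measure.map_smul, Measure.map_fst_prod,
      smul_smul, hmass m₂ p _ (min_le_right _ _), ← add_smul, hwa]
  · rw [Measure.map_add _ _ measurable_snd, Measure.map_smul, Measure.map_snd_prod, hρ₁u,
      smul_smul, hρ ρ₂ hρ₂u, ← Measure.mapₗ_apply_of_measurable measurable_snd, map_sum, hρ₂,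
      ← Finset.sum_add_distrib]
    refine (Finset.sum_congr rfl fun p _ => ?_).trans (hsum m₂)
    rw [Measure.mapₗ_apply_of_measurable measurable_snd, Measure.map_smul, Measure.map_snd_prod,
      smul_smul, hmass m₁ p _ (min_le_left _ _), ← add_smul, hwb]
  · have h0 : ∀ p, (c₁ p).prod (c₂ p) {z | q z.1 ≠ q z.2} = 0 := by
      intro p
      have hae₁ : ∀ᵐ x ∂(c₁ p), q x = p := ProbabilityTheory.ae_cond_mem (hq p)
      have hae₂ : ∀ᵐ x ∂(c₂ p), q x = p := ProbabilityTheory.ae_cond_mem (hq p)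
      have h1 : ∀ᵐ z ∂((c₁ p).prod (c₂ p)), q z.1 = p :=
        Measure.quasiMeasurePreserving_fst.ae hae₁
      have h2 : ∀ᵐ z ∂((c₁ p).prod (c₂ p)), q z.2 = p :=
        Measure.quasiMeasurePreserving_snd.ae hae₂
      have : ∀ᵐ z ∂((c₁ p).prod (c₂ p)), q z.1 = q z.2 := by
        filter_upwards [h1, h2] with z hz hz' using hz.trans hz'.symm
      exact this
    calc _ = δ⁻¹ * ρ₁.prod ρ₂ {z | q z.1 ≠ q z.2} := by simp [h0]
      _ ≤ δ⁻¹ * ρ₁.prod ρ₂ Set.univ := by gcongr; exact Set.subset_univ _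
      _ = δ⁻¹ * δ * δ := by rw [← Set.univ_prod_univ, Measure.prod_prod, hρ₁u, hρ₂u, mul_assoc]
      _ ≤ 1 * δ := by gcongr; exact ENNReal.inv_mul_le_one _
      _ = δ := one_mul _

/-- The coordinates outside a window that contains `γ 0, …, γ (N - 1)` contribute at most
`1 / (N + 1)` to the metric; inside the window the total variation distance of the marginals is a
bound. -/
lemma kantorovich_le_of_window [Finite A] [DiscreteMeasurableSpace A] (γ : ℕ → G) (F : Finset G)
    (N : ℕ) (hF : ∀ i < N, γ i ∈ F) (m₁ m₂ : Measure (G → A)) [IsProbabilityMeasure m₁]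
    [IsProbabilityMeasure m₂] [Fintype (F → A)] :
    kantorovich (shiftDist γ) m₁ m₂ ≤
      ∑ p : F → A, (m₁ (patternSet ⟨F, p⟩) - m₂ (patternSet ⟨F, p⟩)) + ((N : ℝ≥0∞) + 1)⁻¹ := by
  classical
  have hpre : ∀ p : F → A, (fun (t : G → A) (g : F) => t g) ⁻¹' {p} = patternSet ⟨F, p⟩ := by
    intro p; ext t; simp [patternSet, funext_iff]
  have hmeas : Measurable fun (t : G → A) (g : F) => t g :=
    measurable_pi_lambda _ fun g => measurable_pi_apply _
  obtain ⟨ξ, h1, h2, h3⟩ := exists_coupling_of_finite (fun (t : G → A) (g : F) => t g)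
    (fun p => by rw [hpre]; exact measurableSet_patternSet _) m₁ m₂
  simp_rw [hpre] at h3
  have hprob : IsProbabilityMeasure ξ := by
    constructor
    rw [← Set.preimage_univ (f := Prod.fst), ← Measure.map_apply measurable_fst MeasurableSet.univ,
      h1, measure_univ]
  set S : Set ((G → A) × (G → A)) := {z | (fun g : F => z.1 g) ≠ fun g : F => z.2 g} with hS
  have hSm : MeasurableSet S := by
    have : S = ⋃ p : F → A,
        (Prod.fst ⁻¹' patternSet ⟨F, p⟩) ∩ (Prod.snd ⁻¹' patternSet ⟨F, p⟩)ᶜ := by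
      ext z
      simp only [← hpre]
      simp [hS, eq_comm]
    rw [this]
    exact MeasurableSet.iUnion fun p => (measurable_fst (measurableSet_patternSet _)).inter
      (measurable_snd (measurableSet_patternSet _)).compl
  refine (iInf₂_le ξ ⟨h1, h2⟩).trans ?_
  -- `r` is at most `1` on `S`, and at most the weight of the first coordinate outside `F` off `S`
  calc ∫⁻ z, shiftDist γ z.1 z.2 ∂ξ
      ≤ ∫⁻ z, (S.indicator (fun _ => 1) z + ((N : ℝ≥0∞) + 1)⁻¹) ∂ξ := by
        refine lintegral_mono fun z => iSup_le fun i => ?_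
        by_cases hz : z ∈ S
        · rw [Set.indicator_of_mem hz]
          refine le_trans ?_ le_self_add
          refine ENNReal.div_le_of_le_mul ((discreteDist_le_one _ _).trans ?_)
          simp
        · rw [Set.indicator_of_notMem hz, zero_add]
          by_cases hi : i < N
          · have : z.1 (γ i) = z.2 (γ i) := by
              have hz' : (fun g : F => z.1 g) = fun g : F => z.2 g := by simpa [hS] using hz
              exact congrFun hz' ⟨γ i, hF i hi⟩
            simp [discreteDist, this]
          · rw [← one_div]
            gcongr
            · exact discreteDist_le_one _ _
            · exact not_lt.1 hi
    _ = ξ S + ((N : ℝ≥0∞) + 1)⁻¹ := by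
        rw [lintegral_add_right _ measurable_const]
        simp [lintegral_indicator_const hSm]
    _ ≤ _ := by gcongr

lemma tendsto_kantorovich_of_profile [Finite A] [DiscreteMeasurableSpace A] (γ : ℕ → G)
    {ι : Type*} {l : Filter ι} {m : ι → Measure (G → A)} {m' : Measure (G → A)}
    [∀ i, IsProbabilityMeasure (m i)] [IsProbabilityMeasure m']
    (h : Tendsto (fun i => profile (m i)) l (𝓝 (profile m'))) :
    Tendsto (fun i => kantorovich (shiftDist γ) (m i) m') l (𝓝 0) := by
  classical
  have hc : ∀ c : Pattern G A, Tendsto (fun i => m i (patternSet c)) l (𝓝 (m' (patternSet c))) :=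
    fun c => (ENNReal.tendsto_toReal_iff (fun i => measure_ne_top _ _) (measure_ne_top _ _)).1
      (tendsto_pi_nhds.1 h c)
  refine ENNReal.tendsto_nhds_zero.2 fun ε hε => ?_
  obtain ⟨N, hN⟩ := ENNReal.exists_inv_nat_lt (ENNReal.half_pos hε.ne').ne'
  set F : Finset G := (Finset.range N).image γ with hF
  have := Fintype.ofFinite A
  have hs : Tendsto (fun i => ∑ p : F → A,
      (m i (patternSet ⟨F, p⟩) - m' (patternSet ⟨F, p⟩))) l (𝓝 0) := by
    have := tendsto_finsetSum (Finset.univ : Finset (F → A)) fun p _ =>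
      ENNReal.Tendsto.sub (hc ⟨F, p⟩) (tendsto_const_nhds (x := m' (patternSet ⟨F, p⟩)))
        (Or.inl (measure_ne_top _ _))
    simpa using this
  filter_upwards [(ENNReal.tendsto_nhds_zero.1 hs) (ε / 2) (ENNReal.half_pos hε.ne')] with i hi
  refine (kantorovich_le_of_window γ F N (fun j hj => Finset.mem_image_of_mem _
    (Finset.mem_range.2 hj)) (m i) m').trans ?_
  calc _ ≤ ε / 2 + ε / 2 := by
        gcongr
        refine le_trans ?_ hN.le
        gcongr
        exact le_self_add
    _ = ε := ENNReal.add_halves ε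

end Profile

/-! ### Profiles of laws of observables and of labellings -/

section Formulas

variable {G A B V X : Type*} [MeasurableSpace A] [MeasurableSpace B]

lemma measurable_pullbackName (σ : G → Equiv.Perm V) (v : V) :
    Measurable (pullbackName σ v : (V → A) → G → A) :=
  measurable_pi_lambda _ fun _ => measurable_pi_apply _

instance isProbabilityMeasure_localStat [Fintype V] [Nonempty V] (σ : G → Equiv.Perm V)
    (η : Measure (V → A)) [IsProbabilityMeasure η] : IsProbabilityMeasure (localStat σ η) := by
  have h : ∀ v, IsProbabilityMeasure (η.map (pullbackName σ v)) := fun v =>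
    Measure.isProbabilityMeasure_map (measurable_pullbackName σ v).aemeasurable
  constructor
  simp only [localStat, Measure.smul_apply, Measure.coe_finsetSum, Finset.sum_apply, measure_univ,
    Finset.sum_const, Finset.card_univ, smul_eq_mul, nsmul_eq_mul, mul_one]
  exact ENNReal.inv_mul_cancel (by simp) (by simp)

lemma profile_localStat [DiscreteMeasurableSpace A] [Fintype V] (σ : G → Equiv.Perm V)
    (η : Measure (V → A)) [IsProbabilityMeasure η] (c : Pattern G A) :
    profile (localStat σ η) c =
      (Fintype.card V : ℝ)⁻¹ * ∑ v, η.real {τ | ∀ g : c.1, τ (σ g v) = c.2 g} := by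
  have h : ∀ v, IsProbabilityMeasure (η.map (pullbackName σ v)) := fun v =>
    Measure.isProbabilityMeasure_map (measurable_pullbackName σ v).aemeasurable
  rw [profile, localStat, measureReal_ennreal_smul_apply, measureReal_def, Measure.coe_finsetSum,
    Finset.sum_apply, ENNReal.toReal_sum fun v _ => measure_ne_top _ _]
  simp only [ENNReal.toReal_inv, ENNReal.toReal_natCast]
  congr 1
  refine Finset.sum_congr rfl fun v _ => ?_
  rw [Measure.map_apply (measurable_pullbackName σ v) (measurableSet_patternSet c)]
  rfl

/-- The fraction of the points of `V` that satisfy `P`. -/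
noncomputable def freq [Fintype V] (P : V → Prop) : ℝ := {v | P v}.ncard / Fintype.card V

lemma profile_localStat_dirac [DiscreteMeasurableSpace A] [Finite A] [Fintype V]
    (σ : G → Equiv.Perm V) (τ : V → A) (c : Pattern G A) :
    profile (localStat σ (Measure.dirac τ)) c = freq fun v => ∀ g : c.1, τ (σ g v) = c.2 g := by
  classical
  have hm : ∀ v, MeasurableSet {τ : V → A | ∀ g : c.1, τ (σ g v) = c.2 g} := fun v =>
    (Set.toFinite _).measurableSet
  rw [profile_localStat, freq, div_eq_inv_mul]
  congr 1
  simp only [measureReal_def, Measure.dirac_apply' _ (hm _)]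
  rw [Set.ncard_eq_toFinset_card', Finset.card_eq_sum_ones, Set.toFinset_ofPred, Finset.sum_filter]
  push_cast
  refine Finset.sum_congr rfl fun v _ => ?_
  by_cases h : ∀ g : c.1, τ (σ g v) = c.2 g
  · rw [Set.indicator_of_mem (show τ ∈ {τ : V → A | ∀ g : c.1, τ (σ g v) = c.2 g} from h),
      if_pos h]
    simp
  · rw [Set.indicator_of_notMem (show τ ∉ {τ : V → A | ∀ g : c.1, τ (σ g v) = c.2 g} from h),
      if_neg h]
    simp

lemma measurable_orbitMap [Group G] [MeasurableSpace X] [MulAction G X] [MeasurableConstSMul G X]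
    {f : X → A} (hf : Measurable f) : Measurable fun (x : X) (g : G) => f (g • x) :=
  measurable_pi_lambda _ fun g => hf.comp (measurable_const_smul g)

lemma isProbabilityMeasure_distr [Group G] [MeasurableSpace X] [MulAction G X]
    [MeasurableConstSMul G X] (μ : Measure X) [IsProbabilityMeasure μ] {f : X → A}
    (hf : Measurable f) : IsProbabilityMeasure (distr G μ f) :=
  Measure.isProbabilityMeasure_map (measurable_orbitMap hf).aemeasurable

lemma profile_distr [DiscreteMeasurableSpace A] [Group G] [MeasurableSpace X] [MulAction G X]
    [MeasurableConstSMul G X] (μ : Measure X) {f : X → A} (hf : Measurable f) (c : Pattern G A) :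
    profile (distr G μ f) c = μ.real {x | ∀ g : c.1, f ((g : G) • x) = c.2 g} := by
  rw [profile, distr, measureReal_def, Measure.map_apply (measurable_orbitMap hf)
    (measurableSet_patternSet c)]
  rfl

/-- Relabelling by `φ` replaces a pattern by the finitely many patterns above it. -/
lemma profile_map [DiscreteMeasurableSpace A] [Finite A] [DiscreteMeasurableSpace B]
    (φ : A → B) (m : Measure (G → A)) [IsFiniteMeasure m] (c : Pattern G B)
    [Fintype {q : c.1 → A // φ ∘ q = c.2}] :
    profile (m.map (φ ∘ ·)) c = ∑ q : {q : c.1 → A // φ ∘ q = c.2}, profile m ⟨c.1, q⟩ := by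
  have hφ : Measurable (fun t : G → A => φ ∘ t) :=
    measurable_pi_lambda _ fun g => (Measurable.of_discrete (f := φ)).comp (measurable_pi_apply g)
  simp only [profile]
  rw [measureReal_def, Measure.map_apply hφ (measurableSet_patternSet c), ← measureReal_def]
  have : (fun t : G → A => φ ∘ t) ⁻¹' patternSet c =
      ⋃ q : {q : c.1 → A // φ ∘ q = c.2}, patternSet ⟨c.1, q⟩ := by
    ext t
    simp only [patternSet, Set.mem_preimage, Set.mem_ofPred_eq, Set.mem_iUnion]
    constructor
    · exact fun h => ⟨⟨fun g => t g, funext h⟩, fun g => rfl⟩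
    · rintro ⟨q, hq⟩ g
      have := congrFun q.2 g
      simpa [hq g] using this
  rw [this, measureReal_iUnion_fintype]
  · intro q q' hne
    refine Set.disjoint_left.2 fun t ht ht' => hne ?_
    exact Subtype.ext (funext fun g => (ht g).symm.trans (ht' g))
  · exact fun q => measurableSet_patternSet _

lemma tendsto_profile_map [DiscreteMeasurableSpace A] [Finite A] [DiscreteMeasurableSpace B]
    (φ : A → B) {ι : Type*} {l : Filter ι} {m : ι → Measure (G → A)} {m' : Measure (G → A)}
    [∀ i, IsFiniteMeasure (m i)] [IsFiniteMeasure m']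
    (h : Tendsto (fun i => profile (m i)) l (𝓝 (profile m'))) :
    Tendsto (fun i => profile ((m i).map (φ ∘ ·))) l (𝓝 (profile (m'.map (φ ∘ ·)))) := by
  refine tendsto_pi_nhds.2 fun c => ?_
  have := Fintype.ofFinite {q : c.1 → A // φ ∘ q = c.2}
  simp only [profile_map]
  exact tendsto_finsetSum _ fun q _ => tendsto_pi_nhds.1 h _

lemma map_distr [DiscreteMeasurableSpace A] [Group G] [MeasurableSpace X] [MulAction G X]
    [MeasurableConstSMul G X] (μ : Measure X) {f : X → A} (hf : Measurable f) (φ : A → B) :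
    (distr G μ f).map (φ ∘ ·) = distr G μ (φ ∘ f) := by
  have hφ : Measurable (fun t : G → A => φ ∘ t) :=
    measurable_pi_lambda _ fun g => (Measurable.of_discrete (f := φ)).comp (measurable_pi_apply g)
  rw [distr, Measure.map_map hφ (measurable_orbitMap hf)]
  rfl

lemma map_localStat_dirac [DiscreteMeasurableSpace A] [Fintype V] (σ : G → Equiv.Perm V)
    (τ : V → A) (φ : A → B) :
    (localStat σ (Measure.dirac τ)).map (φ ∘ ·) = localStat σ (Measure.dirac (φ ∘ τ)) := by
  have hφ : Measurable (fun t : G → A => φ ∘ t) :=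
    measurable_pi_lambda _ fun g => (Measurable.of_discrete (f := φ)).comp (measurable_pi_apply g)
  rw [localStat, localStat, Measure.map_smul, ← Measure.mapₗ_apply_of_measurable hφ, map_sum]
  congr 1
  refine Finset.sum_congr rfl fun v _ => ?_
  rw [Measure.mapₗ_apply_of_measurable hφ, Measure.map_dirac' (measurable_pullbackName σ v),
    Measure.map_dirac' (measurable_pullbackName σ v), Measure.map_dirac' hφ]
  rfl

end Formulas

/-! ### Finite models and sofic profiles -/

section Models

variable {G : Type*} [Group G]

/-- A map from `G` to the permutations of a finite nonempty set, with no condition imposed. -/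
structure FiniteModel (G : Type*) where
  V : Type
  [fintypeV : Fintype V]
  [nonemptyV : Nonempty V]
  σ : G → Equiv.Perm V

attribute [instance] FiniteModel.fintypeV FiniteModel.nonemptyV

/-- The numbers that have to converge for a sequence of models to be a sofic approximation. -/
noncomputable def FiniteModel.defect (M : FiniteModel G) : G × G → ℝ × ℝ := fun g =>
  (permDist (M.σ g.1) (M.σ g.2), permDist (M.σ g.1 * M.σ g.2) (M.σ (g.1 * g.2)))

open Classical in
/-- The limit of the defects along a sofic approximation. -/
noncomputable def freeDefect (G : Type*) : G × G → ℝ × ℝ := fun g =>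
  (if g.1 = g.2 then 0 else 1, 0)

/-- The `i`-th model of a sofic approximation. -/
def SoficApproximation.model (𝔖 : SoficApproximation G) (i : ℕ) : FiniteModel G where
  V := 𝔖.V i
  σ := 𝔖.σ i

lemma SoficApproximation.tendsto_defect (𝔖 : SoficApproximation G) :
    Tendsto (fun i => (𝔖.model i).defect) atTop (𝓝 (freeDefect G)) := by
  refine tendsto_pi_nhds.2 fun g => (Tendsto.prodMk_nhds ?_ (𝔖.tendsto_mul g.1 g.2))
  by_cases h : g.1 = g.2
  · simp [h, permDist]
  · rw [if_neg h]
    exact 𝔖.tendsto_free _ _ h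

/-- The sofic approximation formed by a sequence of models with the right defects. -/
def SoficApproximation.ofModels (M : ℕ → FiniteModel G)
    (h : Tendsto (fun i => (M i).defect) atTop (𝓝 (freeDefect G))) : SoficApproximation G where
  V i := (M i).V
  σ i := (M i).σ
  tendsto_free g₁ g₂ hg := by
    simpa [freeDefect, hg, FiniteModel.defect] using
      (tendsto_pi_nhds.1 h (g₁, g₂)).fst_nhds
  tendsto_mul g₁ g₂ := (tendsto_pi_nhds.1 h (g₁, g₂)).snd_nhds

variable {A B : Type*} [MeasurableSpace A] [MeasurableSpace B]

/-- A family of cylinder probabilities that is a limit of statistics of labellings along some sofic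
approximation of the group. -/
def IsSoficProfile (v : Pattern G A → ℝ) : Prop :=
  ∃ (𝔖 : SoficApproximation G) (τ : ∀ i, 𝔖.V i → A),
    Tendsto (fun i => profile (localStat (𝔖.σ i) (Measure.dirac (τ i)))) atTop (𝓝 v)

/-- The defect of a model together with the statistics of a labelling of it. -/
noncomputable def labelledDefect (p : Σ M : FiniteModel G, (M.V → A)) :
    (G × G → ℝ × ℝ) × (Pattern G A → ℝ) :=
  (p.1.defect, profile (localStat p.1.σ (Measure.dirac p.2)))

/-- Soficity of a profile is a closure condition on finite models, hence closed. -/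
lemma isSoficProfile_iff [Countable G] [Finite A] {v : Pattern G A → ℝ} :
    IsSoficProfile v ↔
      (freeDefect G, v) ∈ closure (Set.range (labelledDefect (G := G) (A := A))) := by
  rw [mem_closure_iff_seq_limit]
  constructor
  · rintro ⟨𝔖, τ, h⟩
    exact ⟨fun i => labelledDefect ⟨𝔖.model i, τ i⟩, fun i => ⟨_, rfl⟩,
      𝔖.tendsto_defect.prodMk_nhds h⟩
  · rintro ⟨x, hx, hlim⟩
    choose p hp using hx
    obtain rfl : (fun i => labelledDefect (p i)) = x := funext hp
    exact ⟨SoficApproximation.ofModels (fun i => (p i).1) hlim.fst_nhds, fun i => (p i).2,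
      hlim.snd_nhds⟩

lemma isClosed_isSoficProfile [Countable G] [Finite A] :
    IsClosed {v : Pattern G A → ℝ | IsSoficProfile v} := by
  simp only [isSoficProfile_iff]
  exact isClosed_closure.preimage (by fun_prop)

lemma IsSoficProfile.map [DiscreteMeasurableSpace A] [Finite A] [DiscreteMeasurableSpace B]
    (φ : A → B) {m : Measure (G → A)} [IsFiniteMeasure m] (h : IsSoficProfile (profile m)) :
    IsSoficProfile (profile (m.map (φ ∘ ·))) := by
  obtain ⟨𝔖, τ, h⟩ := h
  refine ⟨𝔖, fun i => φ ∘ τ i, ?_⟩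
  simpa only [map_localStat_dirac] using tendsto_profile_map φ h

end Models

/-! ### Products of sofic approximations -/

section Products

lemma freq_pi {κ : Type*} [Fintype κ] {V : κ → Type*} [∀ k, Fintype (V k)]
    [Fintype (∀ k, V k)] (P : ∀ k, V k → Prop) :
    freq (fun v : ∀ k, V k => ∀ k, P k (v k)) = ∏ k, freq (P k) := by
  classical
  simp only [freq, Finset.prod_div_distrib]
  congr 1
  · have : Nat.card {v : ∀ k, V k // ∀ k, P k (v k)} = ∏ k, Nat.card {w : V k // P k w} := by
      rw [Nat.card_congr Equiv.subtypePiEquivPi, Nat.card_pi]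
    exact_mod_cast this
  · rw [← Nat.card_eq_fintype_card, Nat.card_pi]
    push_cast
    simp

lemma permDist_eq_one_sub {V : Type*} [Fintype V] [Nonempty V] (p q : Equiv.Perm V) :
    permDist p q = 1 - freq fun v => p v = q v := by
  have h := Set.ncard_add_ncard_compl {v | p v = q v}
  have hc : {v | p v = q v}ᶜ = {v | p v ≠ q v} := rfl
  rw [hc, Nat.card_eq_fintype_card] at h
  have h0 : (Fintype.card V : ℝ) ≠ 0 := by simp
  rw [permDist, freq, eq_sub_iff_add_eq, ← add_div, div_eq_one_iff_eq h0, add_comm]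
  exact_mod_cast h

variable {G : Type*} [Group G] {κ : Type} [Fintype κ]

lemma permDist_pi {V : κ → Type*} [∀ k, Fintype (V k)] [∀ k, Nonempty (V k)]
    [Fintype (∀ k, V k)] (p q : ∀ k, Equiv.Perm (V k)) :
    permDist (Equiv.piCongrRight p) (Equiv.piCongrRight q) =
      1 - ∏ k, (1 - permDist (p k) (q k)) := by
  rw [permDist_eq_one_sub]
  simp only [permDist_eq_one_sub, sub_sub_cancel]
  rw [← freq_pi]
  congr 2
  ext v
  simp [funext_iff]

open Classical in
/-- The product of finitely many (at least one) sofic approximations. -/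
noncomputable def SoficApproximation.pi [Nonempty κ] (𝔖 : κ → SoficApproximation G) :
    SoficApproximation G where
  V i := ∀ k, (𝔖 k).V i
  σ i g := Equiv.piCongrRight fun k => (𝔖 k).σ i g
  tendsto_free g₁ g₂ h := by
    simp only [permDist_pi]
    have := tendsto_finsetProd (Finset.univ : Finset κ) fun k _ =>
      ((𝔖 k).tendsto_free g₁ g₂ h).const_sub 1
    simpa using this.const_sub 1
  tendsto_mul g₁ g₂ := by
    have h : ∀ i, (Equiv.piCongrRight fun k => (𝔖 k).σ i g₁) *
        (Equiv.piCongrRight fun k => (𝔖 k).σ i g₂) =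
        Equiv.piCongrRight fun k => (𝔖 k).σ i g₁ * (𝔖 k).σ i g₂ := fun i => rfl
    simp only [h, permDist_pi]
    have := tendsto_finsetProd (Finset.univ : Finset κ) fun k _ =>
      ((𝔖 k).tendsto_mul g₁ g₂).const_sub 1
    simpa using this.const_sub 1

variable {A : Type*} [MeasurableSpace A] [DiscreteMeasurableSpace A] [Finite A]

/-- Independent joinings of sofic laws are sofic: use the product of the approximations. -/
lemma IsSoficProfile.pi [Nonempty κ] [MeasurableSpace (κ → A)] [DiscreteMeasurableSpace (κ → A)]
    {v : κ → Pattern G A → ℝ} (h : ∀ k, IsSoficProfile (v k)) :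
    IsSoficProfile (A := κ → A) fun c => ∏ k, v k ⟨c.1, fun g => c.2 g k⟩ := by
  choose 𝔖 τ hτ using h
  refine ⟨SoficApproximation.pi 𝔖, fun i v k => τ k i (v k), tendsto_pi_nhds.2 fun c => ?_⟩
  have key : ∀ i, profile (localStat ((SoficApproximation.pi 𝔖).σ i)
      (Measure.dirac fun v k => τ k i (v k))) c =
      ∏ k, profile (localStat ((𝔖 k).σ i) (Measure.dirac (τ k i))) ⟨c.1, fun g => c.2 g k⟩ := by
    intro i
    simp only [profile_localStat_dirac]
    let : Fintype (∀ k, (𝔖 k).V i) := (SoficApproximation.pi 𝔖).fintypeV i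
    refine Eq.trans ?_ (freq_pi (V := fun k => (𝔖 k).V i) _)
    congr 1
    ext v
    simp only [funext_iff]
    exact forall_comm
  simp only [key]
  exact tendsto_finsetProd _ fun k _ => tendsto_pi_nhds.1 (hτ k) _

end Products

/-! ### Sofic actions and sofic profiles -/

section Sofic

lemma exists_equiv_fin_succ (A : Type*) [Finite A] [Nonempty A] :
    ∃ m, Nonempty (A ≃ Fin (m + 1)) := by
  obtain ⟨n, ⟨e⟩⟩ := Finite.exists_equiv_fin A
  cases n with
  | zero => exact (e (Classical.arbitrary A)).elim0
  | succ m => exact ⟨m, ⟨e⟩⟩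

lemma exists_seq_forall_mem_closure {T E : Type*} [Nonempty T] [TopologicalSpace E]
    [SecondCountableTopology E] (P : T → E) :
    ∃ u : ℕ → T, ∀ t, P t ∈ closure (Set.range (P ∘ u)) := by
  have : Nonempty (Set.range P) := (Set.range_nonempty P).to_subtype
  obtain ⟨w, hw⟩ := TopologicalSpace.exists_dense_seq (Set.range P)
  choose u hu using fun i => (w i).2
  refine ⟨u, fun t => ?_⟩
  have := map_mem_closure continuous_subtype_val (hw ⟨P t, t, rfl⟩)
    (t := Set.range (P ∘ u)) (by rintro _ ⟨i, rfl⟩; exact ⟨i, hu i⟩)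
  exact this

variable {G : Type*} [Group G] {γ : ℕ → G} {X : Type*} [MeasurableSpace X]
  [MulAction G X] [MeasurableConstSMul G X] {μ : Measure X} [IsProbabilityMeasure μ]

lemma IsSofic.isSoficProfile (hγ : Function.Surjective γ) (h : IsSofic γ μ) {A : Type} [Finite A]
    [MeasurableSpace A] [DiscreteMeasurableSpace A] {f : X → A} (hf : Measurable f) :
    IsSoficProfile (profile (distr G μ f)) := by
  obtain ⟨𝔖, h⟩ := h
  obtain ⟨k, hk, τ, hτ⟩ := h A f hf
  have := isProbabilityMeasure_distr (G := G) μ hf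
  exact ⟨SoficApproximation.ofModels (fun j => 𝔖.model (k j))
    (𝔖.tendsto_defect.comp hk.tendsto_atTop), τ, tendsto_profile_of_kantorovich hγ hτ⟩

/-- If each law of an observable comes from some sofic approximation, then a single sofic
approximation serves all observables: it interleaves models for a countable family of observables
whose laws are dense. -/
lemma isSofic_of_forall_isSoficProfile [Countable G]
    (h : ∀ (m : ℕ) (f : X → Fin (m + 1)), Measurable f → IsSoficProfile (profile (distr G μ f))) :
    IsSofic γ μ := by
  have : Nonempty X := nonempty_of_isProbabilityMeasure μ
  have hne : ∀ m, Nonempty {f : X → Fin (m + 1) // Measurable f} := fun m =>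
    ⟨⟨fun _ => 0, measurable_const⟩⟩
  choose u hu using fun m => exists_seq_forall_mem_closure
    fun f : {f : X → Fin (m + 1) // Measurable f} => profile (distr G μ f.1)
  obtain ⟨U, hU⟩ := (𝓝 (freeDefect G)).exists_antitone_basis
  choose W hW using fun m j => (𝓝 (profile (distr G μ (u m j).1))).exists_antitone_basis
  -- the index `n` encodes an observable, given by `m` and `j`, and a dummy that makes every
  -- observable recur
  have hM : ∀ n : ℕ, ∃ M : FiniteModel G, M.defect ∈ U n ∧ ∀ m j, n.unpair.1.unpair = (m, j) →
      ∃ τ : M.V → Fin (m + 1), profile (localStat M.σ (Measure.dirac τ)) ∈ W m j n := by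
    intro n
    obtain ⟨m, j⟩ := n.unpair.1.unpair
    obtain ⟨_, hy, ⟨M, τ⟩, rfl⟩ := mem_closure_iff_nhds.1 (isSoficProfile_iff.1 (h m _ (u m j).2)) _
      (prod_mem_nhds (hU.mem n) ((hW m j).mem n))
    exact ⟨M, hy.1, by rintro _ _ ⟨⟩; exact ⟨τ, hy.2⟩⟩
  choose M hMU hMW using hM
  refine ⟨SoficApproximation.ofModels M (hU.tendsto hMU), ?_⟩
  intro A _ _ _ f hf
  have : Nonempty A := ‹Nonempty X›.map f
  obtain ⟨m, ⟨e⟩⟩ := exists_equiv_fin_succ A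
  have hef : Measurable (e ∘ f) := Measurable.of_discrete.comp hf
  obtain ⟨O, hO⟩ := (𝓝 (profile (distr G μ (e ∘ f)))).exists_antitone_basis
  have hfreq : ∀ q, ∃ᶠ n in atTop, ∃ τ : (M n).V → Fin (m + 1),
      profile (localStat (M n).σ (Measure.dirac τ)) ∈ O q := by
    intro q
    obtain ⟨_, hx, j, rfl⟩ := mem_closure_iff_nhds.1 (hu m ⟨e ∘ f, hef⟩) _
      (interior_mem_nhds.2 (hO.mem q))
    obtain ⟨n₀, hn₀⟩ := (hW m j).mem_iff.1 (mem_interior_iff_mem_nhds.1 hx)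
    refine frequently_atTop.2 fun N => ?_
    have hle := Nat.right_le_pair (Nat.pair m j) (max N n₀)
    refine ⟨Nat.pair (Nat.pair m j) (max N n₀), (le_max_left _ _).trans hle, ?_⟩
    obtain ⟨τ, hτ⟩ := hMW (Nat.pair (Nat.pair m j) (max N n₀)) m j (by simp)
    exact ⟨τ, hn₀ ((hW m j).antitone ((le_max_right _ _).trans hle) hτ)⟩
  obtain ⟨k, hk, hkO⟩ := extraction_forall_of_frequently hfreq
  choose τ hτ using hkO
  refine ⟨k, hk, fun j => e.symm ∘ τ j, ?_⟩
  have := isProbabilityMeasure_distr (G := G) μ hef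
  have := isProbabilityMeasure_distr (G := G) μ hf
  have hlim := tendsto_profile_map e.symm (hO.tendsto hτ)
  rw [map_distr μ hef] at hlim
  simp only [map_localStat_dirac, ← Function.comp_assoc, Equiv.symm_comp_self,
    Function.id_comp] at hlim
  have hpr : ∀ j, IsProbabilityMeasure (localStat (M (k j)).σ
    (Measure.dirac (e.symm ∘ τ j))) := fun j => inferInstance
  exact tendsto_kantorovich_of_profile γ hlim

/-- The law of an observable depends continuously on it for convergence in measure. -/
lemma tendsto_profile_distr [SMulInvariantMeasure G X μ] {A : Type*} [MeasurableSpace A]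
    [Finite A] [DiscreteMeasurableSpace A] {f : X → A} (hf : Measurable f) {F : ℕ → X → A}
    (hF : ∀ q, Measurable (F q))
    (h : Tendsto (fun q => μ.real {x | F q x ≠ f x}) atTop (𝓝 0)) :
    Tendsto (fun q => profile (distr G μ (F q))) atTop (𝓝 (profile (distr G μ f))) := by
  refine tendsto_pi_nhds.2 fun c => tendsto_iff_dist_tendsto_zero.2 ?_
  have hz : Tendsto (fun q => (c.1.card : ℝ) * μ.real {x | F q x ≠ f x}) atTop (𝓝 0) := by
    simpa using h.const_mul (c.1.card : ℝ)
  refine squeeze_zero (fun _ => dist_nonneg) (fun q => ?_) hz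
  have hms : ∀ f' : X → A, Measurable f' →
      MeasurableSet {x | ∀ g : c.1, f' ((g : G) • x) = c.2 g} := fun f' hf' =>
    measurable_orbitMap hf' (measurableSet_patternSet c)
  rw [profile_distr μ (hF q), profile_distr μ hf, Real.dist_eq]
  refine (abs_measureReal_sub_le_measureReal_symmDiff (hms _ (hF q)).nullMeasurableSet
    (hms _ hf).nullMeasurableSet).trans ?_
  -- the two patterns at `x` differ only if the observables differ at some translate of `x`
  have hsub : symmDiff {x | ∀ g : c.1, F q ((g : G) • x) = c.2 g}
      {x | ∀ g : c.1, f ((g : G) • x) = c.2 g} ⊆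
      ⋃ g ∈ c.1, (fun x => g • x) ⁻¹' {x | F q x ≠ f x} := by
    intro x hx
    by_contra hcon
    simp only [Set.mem_iUnion, Set.mem_preimage, Set.mem_ofPred_eq, exists_prop, not_exists,
      not_and, not_not] at hcon
    have : (∀ g : c.1, F q ((g : G) • x) = c.2 g) ↔ ∀ g : c.1, f ((g : G) • x) = c.2 g :=
      forall_congr' fun g => by rw [hcon g g.2]
    rcases hx with ⟨h1, h2⟩ | ⟨h1, h2⟩
    · exact h2 (this.1 h1)
    · exact h2 (this.2 h1)
  refine (measureReal_mono hsub (measure_ne_top _ _)).trans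
    ((measureReal_biUnion_finset_le _ _).trans ?_)
  have hne : MeasurableSet {x | F q x ≠ f x} := (measurableSet_eq_fun (hF q) hf).compl
  refine (Finset.sum_le_card_nsmul _ _ (μ.real {x | F q x ≠ f x}) fun g _ => ?_).trans
    (by rw [nsmul_eq_mul])
  rw [measureReal_def, measure_preimage_smul_of_nullMeasurableSet hne.nullMeasurableSet,
    measureReal_def]

end Sofic

/-! ### Approximation by observables from a generating sequence -/

section Approximation

open scoped symmDiff

/-- An observable is approximated in measure by functions of the members of a generating refining
sequence of observables. -/
lemma exists_approx_of_generating {X A : Type*} [mX : MeasurableSpace X] (μ : Measure X)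
    [IsProbabilityMeasure μ] {B : ℕ → Type*} (F : ∀ n, X → B n)
    (hrefine : ∀ m n, m ≤ n → ∃ ψ : B n → B m, F m = ψ ∘ F n)
    (hgen : mX = MeasurableSpace.generateFrom {S | ∃ n T, S = F n ⁻¹' T})
    [Finite A] [MeasurableSpace A] [DiscreteMeasurableSpace A] {f : X → A} (hf : Measurable f)
    {ε : ℝ} (hε : 0 < ε) : ∃ n, ∃ φ : B n → A, μ.real {x | φ (F n x) ≠ f x} ≤ ε := by
  classical
  have := Fintype.ofFinite A
  have : Nonempty X := nonempty_of_isProbabilityMeasure μ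
  have : Nonempty A := this.map f
  have halg : IsSetAlgebra {S | ∃ n, ∃ T : Set (B n), S = F n ⁻¹' T} := by
    refine ⟨⟨0, ∅, rfl⟩, ?_, ?_⟩
    · rintro _ ⟨n, T, rfl⟩
      exact ⟨n, Tᶜ, rfl⟩
    · rintro _ _ ⟨n, T, rfl⟩ ⟨n', T', rfl⟩
      obtain ⟨ψ, hψ⟩ := hrefine n (max n n') (le_max_left _ _)
      obtain ⟨ψ', hψ'⟩ := hrefine n' (max n n') (le_max_right _ _)
      exact ⟨max n n', ψ ⁻¹' T ∪ ψ' ⁻¹' T', by rw [hψ, hψ']; rfl⟩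
  have hd := Measure.MeasureDense.of_generateFrom_isSetAlgebra_finite (μ := μ) halg hgen
  have hcard : 0 < (Fintype.card A : ℝ) := by exact_mod_cast Fintype.card_pos
  have hex : ∀ a : A, ∃ n, ∃ T : Set (B n),
      μ ((f ⁻¹' {a}) ∆ (F n ⁻¹' T)) < ENNReal.ofReal (ε / Fintype.card A) := by
    intro a
    obtain ⟨_, ⟨n, T, rfl⟩, h⟩ := hd.approx (f ⁻¹' {a}) (hf MeasurableSet.of_discrete)
      (measure_ne_top _ _) (ε / Fintype.card A) (by positivity)
    exact ⟨n, T, h⟩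
  choose n T hT using hex
  set N := Finset.univ.sup n
  choose ψ hψ using fun a => hrefine (n a) N (Finset.le_sup (Finset.mem_univ a))
  -- `φ b` is a value `a` whose approximating set contains `b`; off the symmetric differences there
  -- is exactly one
  refine ⟨N, fun b => if h : ∃ a, ψ a b ∈ T a then h.choose else Classical.arbitrary A, ?_⟩
  refine (measureReal_mono (s₂ := ⋃ a ∈ (Finset.univ : Finset A), (f ⁻¹' {a}) ∆ (F (n a) ⁻¹' T a))
    (fun x hx => ?_) (measure_ne_top _ _)).trans ((measureReal_biUnion_finset_le _ _).trans
      ((Finset.sum_le_card_nsmul _ _ (ε / Fintype.card A) fun a _ => ?_).trans ?_))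
  · by_contra hcon
    have hiff : ∀ a, f x = a ↔ ψ a (F N x) ∈ T a := by
      intro a
      have h1 : x ∉ (f ⁻¹' {a}) ∆ (F (n a) ⁻¹' T a) := by
        simp only [Set.mem_iUnion, not_exists] at hcon
        exact hcon a (Finset.mem_univ a)
      have h2 : F (n a) x = ψ a (F N x) := congrFun (hψ a) x
      rw [Set.mem_symmDiff] at h1
      simp only [Set.mem_preimage, Set.mem_singleton_iff, h2] at h1
      tauto
    refine hx ?_
    have hE : ∃ a, ψ a (F N x) ∈ T a := ⟨f x, (hiff _).1 rfl⟩
    simp only [dif_pos hE]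
    exact ((hiff _).2 hE.choose_spec).symm
  · exact ENNReal.toReal_le_of_le_ofReal (by positivity) (hT a).le
  · rw [Finset.card_univ, nsmul_eq_mul, mul_div_cancel₀ _ hcard.ne']

end Approximation

/-! ### Countable products of sofic actions -/

section InfiniteProduct

open MeasurableSpace

variable {G : Type*} [Group G] {ι : Type*} {Y : ι → Type*} [∀ i, MeasurableSpace (Y i)]
  [∀ i, MulAction G (Y i)] [∀ i, MeasurableConstSMul G (Y i)] (ν : ∀ i, Measure (Y i))
  [∀ i, IsProbabilityMeasure (ν i)]

instance smulInvariantMeasure_infinitePi [∀ i, SMulInvariantMeasure G (Y i) (ν i)] :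
    SMulInvariantMeasure G (∀ i, Y i) (Measure.infinitePi ν) where
  measure_preimage_smul g s hs := by
    rw [← Measure.map_apply (measurable_const_smul g) hs]
    congr 1
    have := Measure.infinitePi_map_pi (μ := ν) (f := fun i y => g • y)
      (fun i => measurable_const_smul g)
    simp only [fun i => (measurePreserving_smul g (ν i)).map_eq] at this
    exact this

/-- Observables of distinct coordinates are independent, jointly with all their translates. -/
lemma profile_distr_infinitePi {κ : Type*} [Fintype κ] {s : κ → ι} (hs : Function.Injective s)
    {A : Type*} [MeasurableSpace A] [DiscreteMeasurableSpace A] [Finite A]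
    [DiscreteMeasurableSpace (κ → A)]
    {h : ∀ i, Y i → A} (hh : ∀ i, Measurable (h i)) (c : Pattern G (κ → A)) :
    profile (distr G (Measure.infinitePi ν) fun y k => h (s k) (y (s k))) c =
      ∏ k, profile (distr G (ν (s k)) (h (s k))) ⟨c.1, fun g => c.2 g k⟩ := by
  classical
  have hm : Measurable fun (y : ∀ i, Y i) (k : κ) => h (s k) (y (s k)) :=
    measurable_pi_lambda _ fun k => (hh _).comp (measurable_pi_apply _)
  set t : ∀ i, Set (Y i) := fun i =>
    {y | ∀ k, s k = i → ∀ g : c.1, h i ((g : G) • y) = c.2 g k} with ht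
  have htm : ∀ i, MeasurableSet (t i) := by
    intro i
    have : t i = ⋂ k, ⋂ (_ : s k = i), ⋂ g : c.1, (fun y => h i ((g : G) • y)) ⁻¹' {c.2 g k} := by
      ext y; simp [ht]
    rw [this]
    exact MeasurableSet.iInter fun k => MeasurableSet.iInter fun _ => MeasurableSet.iInter fun g =>
      ((hh i).comp (measurable_const_smul _)) MeasurableSet.of_discrete
  have hset : {y : ∀ i, Y i | ∀ g : c.1, (fun k => h (s k) (((g : G) • y) (s k))) = c.2 g} =
      Set.pi (Finset.univ.image s) t := by
    ext y
    simp only [ht, Set.mem_ofPred_eq, Set.mem_pi, Finset.coe_image, Finset.coe_univ,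
      Set.image_univ, Set.mem_range, forall_exists_index, forall_apply_eq_imp_iff, funext_iff,
      Pi.smul_apply]
    constructor
    · intro H k k' hk g
      rw [hs hk]; exact H g k
    · exact fun H g k => H k k rfl g
  rw [profile_distr _ hm, hset, measureReal_def, Measure.infinitePi_pi _ fun i _ => htm i,
    Finset.prod_image fun k _ k' _ hk => hs hk, ENNReal.toReal_prod]
  refine Finset.prod_congr rfl fun k _ => ?_
  rw [profile_distr _ (hh _), measureReal_def]
  congr 2
  ext y
  simp only [ht, Set.mem_ofPred_eq]
  constructor
  · exact fun H g => H k rfl g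
  · intro H k' hk' g
    rw [hs hk']; exact H g

end InfiniteProduct

section CountableProduct

open MeasurableSpace

variable {G : Type*} [Group G] [Countable G] {γ : ℕ → G} {Y : ℕ → Type*}
  [∀ i, MeasurableSpace (Y i)] [∀ i, CountablyGenerated (Y i)]
  [∀ i, MulAction G (Y i)] [∀ i, MeasurableConstSMul G (Y i)] {ν : ∀ i, Measure (Y i)}
  [∀ i, IsProbabilityMeasure (ν i)] [∀ i, SMulInvariantMeasure G (Y i) (ν i)]

open Classical in
/-- Membership in the first `n + 1` sets of a generating sequence. -/
noncomputable def cellCode (Z : Type*) [MeasurableSpace Z] [CountablyGenerated Z] (n : ℕ) (z : Z) :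
    Fin (n + 1) → Bool := fun j => decide (z ∈ natGeneratingSequence Z j)

lemma measurable_cellCode (Z : Type*) [MeasurableSpace Z] [CountablyGenerated Z] (n : ℕ) :
    Measurable (cellCode Z n) := by
  classical
  refine measurable_pi_lambda _ fun j => measurable_to_bool ?_
  have : (fun z => cellCode Z n z j) ⁻¹' {true} = natGeneratingSequence Z j := by
    ext z; simp [cellCode]
  rw [this]
  exact measurableSet_natGeneratingSequence _

/-- A countable product of sofic actions is sofic. -/
theorem isSofic_infinitePi (hγ : Function.Surjective γ) (h : ∀ i, IsSofic γ (ν i)) :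
    IsSofic γ (Measure.infinitePi ν) := by
  classical
  refine isSofic_of_forall_isSoficProfile fun m f hf => ?_
  -- observables of finitely many coordinates, each read through finitely many generating sets; they
  -- refine each other and generate the product σ-algebra
  set F : ∀ n, (∀ i, Y i) → Fin (n + 1) → Fin (n + 1) → Bool :=
    fun n y k => cellCode (Y k) n (y k) with hF
  have hFm : ∀ n, Measurable (F n) := fun n => measurable_pi_lambda _ fun k =>
    (measurable_cellCode _ n).comp (measurable_pi_apply _)
  have hrefine : ∀ m n, m ≤ n →
      ∃ ψ : (Fin (n + 1) → Fin (n + 1) → Bool) → Fin (m + 1) → Fin (m + 1) → Bool,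
        F m = ψ ∘ F n := fun m n hmn =>
    ⟨fun b k j => b (k.castLE (by omega)) (j.castLE (by omega)), rfl⟩
  have hgen : (MeasurableSpace.pi : MeasurableSpace (∀ i, Y i)) =
      generateFrom {S | ∃ n T, S = F n ⁻¹' T} := by
    apply le_antisymm
    · refine iSup_le fun i => ?_
      rw [← generateFrom_natGeneratingSequence (Y i), comap_generateFrom]
      refine generateFrom_le ?_
      rintro _ ⟨_, ⟨j, rfl⟩, rfl⟩
      refine measurableSet_generateFrom ⟨max i j,
        {b | b ⟨i, by omega⟩ ⟨j, by omega⟩ = true}, ?_⟩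
      ext y
      simp [hF, cellCode]
    · refine generateFrom_le ?_
      rintro _ ⟨n, T, rfl⟩
      exact hFm n MeasurableSet.of_discrete
  choose n φ hφ using fun q : ℕ => exists_approx_of_generating (Measure.infinitePi ν) F hrefine
    hgen hf (Nat.one_div_pos_of_nat (α := ℝ) (n := q))
  have hlim := tendsto_profile_distr (G := G) (μ := Measure.infinitePi ν) hf
    (F := fun q => φ q ∘ F (n q)) (fun q => (Measurable.of_discrete (f := φ q)).comp (hFm _))
    (squeeze_zero (fun _ => measureReal_nonneg) hφ tendsto_one_div_add_atTop_nhds_zero_nat)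
  refine isClosed_isSoficProfile.mem_of_tendsto hlim (Eventually.of_forall fun q => ?_)
  have := isProbabilityMeasure_distr (G := G) (Measure.infinitePi ν) (hFm (n q))
  rw [← map_distr _ (hFm (n q))]
  refine IsSoficProfile.map (φ q) ?_
  have key := IsSoficProfile.pi (G := G) (κ := Fin (n q + 1)) fun k =>
    (h k).isSoficProfile hγ (measurable_cellCode (Y k) (n q))
  convert key using 2 with c
  exact profile_distr_infinitePi ν (s := fun k : Fin (n q + 1) => (k : ℕ)) Fin.val_injective
    (h := fun i => cellCode (Y i) (n q)) (fun i => measurable_cellCode _ _) c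

end CountableProduct

/-! ### A universal sofic action -/

section Universal

variable {G : Type*} [Group G] {γ : ℕ → G}

/-- A sofic action on a standard probability space whose underlying set lives in `Type`. -/
structure SoficSystem (γ : ℕ → G) where
  Y : Type
  [measurableSpaceY : MeasurableSpace Y]
  [standardBorelSpaceY : StandardBorelSpace Y]
  [mulActionY : MulAction G Y]
  [measurableConstSMulY : MeasurableConstSMul G Y]
  ν : Measure Y
  [isProbabilityMeasureν : IsProbabilityMeasure ν]
  [smulInvariantMeasureν : SMulInvariantMeasure G Y ν]
  isSofic : IsSofic γ ν

attribute [instance] SoficSystem.measurableSpaceY SoficSystem.standardBorelSpaceY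
  SoficSystem.mulActionY SoficSystem.measurableConstSMulY SoficSystem.isProbabilityMeasureν
  SoficSystem.smulInvariantMeasureν

/-- A sofic action in any universe is isomorphic to one on a Borel subset of the line. -/
lemma exists_soficSystem_distr_eq {X : Type*} [MeasurableSpace X] [StandardBorelSpace X]
    [MulAction G X] [MeasurableConstSMul G X] (μ : Measure X) [IsProbabilityMeasure μ]
    [SMulInvariantMeasure G X μ] (hμ : IsSofic γ μ) :
    ∃ S : SoficSystem γ, ∀ (A : Type) [MeasurableSpace A] (f : X → A), Measurable f →
      ∃ f' : S.Y → A, Measurable f' ∧ distr G S.ν f' = distr G μ f := by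
  obtain ⟨e, he⟩ := exists_measurableEmbedding_real X
  let E : X ≃ᵐ Set.range e := he.equivRange
  let act : MulAction G (Set.range e) := E.symm.toEquiv.mulAction G
  have hact : ∀ (g : G) (y : Set.range e), g • y = E (g • E.symm y) := fun g y => rfl
  have hsb : StandardBorelSpace (Set.range e) := he.measurableSet_range.standardBorel
  have hms : MeasurableConstSMul G (Set.range e) :=
    ⟨fun g => E.measurable.comp ((measurable_const_smul g).comp E.symm.measurable)⟩
  have hpr : IsProbabilityMeasure (μ.map E) :=
    Measure.isProbabilityMeasure_map E.measurable.aemeasurable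
  have hinv : SMulInvariantMeasure G (Set.range e) (μ.map E) := by
    refine ⟨fun g s hs => ?_⟩
    rw [E.map_apply, E.map_apply, ← measure_preimage_smul (μ := μ) g (E ⁻¹' s)]
    congr 1
    ext x
    simp [hact]
  have hdistr : ∀ (A : Type) [MeasurableSpace A] (f : Set.range e → A), Measurable f →
      distr G (μ.map E) f = distr G μ (f ∘ E) := by
    intro A _ f hf
    rw [distr, Measure.map_map (measurable_orbitMap hf) E.measurable, distr]
    congr 1
    ext x g
    simp [hact]
  refine ⟨{ Y := Set.range e, ν := μ.map E, isSofic := ?_ }, fun A _ f hf =>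
    ⟨f ∘ E.symm, hf.comp E.symm.measurable, ?_⟩⟩
  · obtain ⟨𝔖, h⟩ := hμ
    refine ⟨𝔖, fun A _ _ _ f hf => ?_⟩
    rw [hdistr A f hf]
    exact h A (f ∘ E) (hf.comp E.measurable)
  · refine (hdistr A _ (hf.comp E.symm.measurable)).trans ?_
    congr 1
    ext x
    simp

lemma distr_infinitePi_eval {Y : ℕ → Type*} [∀ i, MeasurableSpace (Y i)]
    [∀ i, MulAction G (Y i)] [∀ i, MeasurableConstSMul G (Y i)] (ν : ∀ i, Measure (Y i))
    [∀ i, IsProbabilityMeasure (ν i)] {A : Type*} [MeasurableSpace A] (k : ℕ) {f : Y k → A}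
    (hf : Measurable f) :
    distr G (Measure.infinitePi ν) (fun y => f (y k)) = distr G (ν k) f := by
  rw [distr, distr, ← Measure.infinitePi_map_eval ν k,
    Measure.map_map (measurable_orbitMap hf) (measurable_pi_apply k)]
  rfl

/-- The product of countably many sofic actions whose observables have, together, a dense set of
laws is universal. -/
theorem exists_isUniversalSofic [Countable G] (hγ : Function.Surjective γ)
    [Nonempty (SoficSystem γ)] : ∃ S : SoficSystem γ, IsUniversalSofic γ S.ν := by
  have hne : ∀ m, Nonempty (Σ S : SoficSystem γ, {f : S.Y → Fin (m + 1) // Measurable f}) :=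
    fun m => ⟨⟨Classical.arbitrary _, fun _ => 0, measurable_const⟩⟩
  choose u hu using fun m => exists_seq_forall_mem_closure
    fun t : Σ S : SoficSystem γ, {f : S.Y → Fin (m + 1) // Measurable f} =>
      profile (distr G t.1.ν t.2.1)
  obtain ⟨S, hS⟩ : ∃ S : ℕ → SoficSystem γ, ∀ m j, ∃ k, ∃ f : (S k).Y → Fin (m + 1),
      Measurable f ∧ profile (distr G (S k).ν f) = profile (distr G (u m j).1.ν (u m j).2.1) := by
    refine ⟨fun k => (u k.unpair.1 k.unpair.2).1, fun m j => ⟨Nat.pair m j, ?_⟩⟩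
    beta_reduce
    rw [Nat.unpair_pair]
    exact ⟨_, (u m j).2.2, rfl⟩
  have hsof : IsSofic γ (Measure.infinitePi fun k => (S k).ν) :=
    isSofic_infinitePi hγ fun k => (S k).isSofic
  refine ⟨{ Y := ∀ k, (S k).Y, ν := Measure.infinitePi fun k => (S k).ν, isSofic := hsof },
    hsof, ?_⟩
  intro Y _ _ _ _ ν _ _ hν A _ _ _ f hf ε hε
  have : Nonempty Y := nonempty_of_isProbabilityMeasure ν
  have : Nonempty A := this.map f
  obtain ⟨m, ⟨e⟩⟩ := exists_equiv_fin_succ A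
  have hef : Measurable (e ∘ f) := Measurable.of_discrete.comp hf
  obtain ⟨x, hx, hlim⟩ := mem_closure_iff_seq_limit.1
    (hu m ⟨{ Y := Y, ν := ν, isSofic := hν }, e ∘ f, hef⟩)
  choose j hj using hx
  choose k h hh hk using fun q => hS m (j q)
  have hm : ∀ q, Measurable fun y : ∀ k, (S k).Y => h q (y (k q)) := fun q =>
    (hh q).comp (measurable_pi_apply _)
  have hpr := fun q => isProbabilityMeasure_distr (G := G)
    (Measure.infinitePi fun k => (S k).ν) (hm q)
  have hpr' := isProbabilityMeasure_distr (G := G) ν hef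
  have hpr'' := isProbabilityMeasure_distr (G := G) ν hf
  have hx' : (fun q => profile (distr G (Measure.infinitePi fun k => (S k).ν)
      fun y => h q (y (k q)))) = x := by
    funext q
    rw [distr_infinitePi_eval _ _ (hh q), hk q]
    exact hj q
  rw [← hx'] at hlim
  have hlim' := tendsto_profile_map e.symm hlim
  simp only [map_distr _ (hm _), map_distr _ hef, ← Function.comp_assoc, Equiv.symm_comp_self,
    Function.id_comp] at hlim'
  have hes : ∀ q, Measurable (e.symm ∘ fun y : ∀ k, (S k).Y => h q (y (k q))) := fun q =>
    Measurable.of_discrete.comp (hm q)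
  have hpr3 := fun q => isProbabilityMeasure_distr (G := G)
    (Measure.infinitePi fun k => (S k).ν) (hes q)
  obtain ⟨q, hq⟩ := ((tendsto_kantorovich_of_profile γ hlim').eventually_lt_const hε).exists
  exact ⟨_, hes q, hq⟩

end Universal

/-! ### Maximal sofic approximations -/

section Maximal

/-- A diagonal choice: if each of countably many requirements can be met from some index on, then
more and more of them can be met. -/
lemma exists_diagonal {T : ℕ → Type*} [∀ i, Nonempty (T i)] (R : ℕ → ∀ i, T i → Prop)
    (h : ∀ N, ∀ᶠ i in atTop, ∃ t, R N i t) :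
    ∃ (t : ∀ i, T i) (n : ℕ → ℕ), Tendsto n atTop atTop ∧ ∀ᶠ i in atTop, R (n i) i (t i) := by
  classical
  -- at the index `i`, the strongest requirement among the first `i` that can be met
  set n : ℕ → ℕ := fun i => Nat.findGreatest (fun N => ∃ t, R N i t) i with hn
  refine ⟨fun i => if h : ∃ t, R (n i) i t then h.choose else Classical.arbitrary _, n, ?_, ?_⟩
  · refine tendsto_atTop.2 fun N => ?_
    filter_upwards [h N, eventually_ge_atTop N] with i hi hNi
    exact Nat.le_findGreatest hNi hi
  · filter_upwards [h 0] with i hi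
    have : ∃ t, R (n i) i t :=
      Nat.findGreatest_spec (P := fun N => ∃ t, R N i t) (Nat.zero_le i) hi
    simp only [dif_pos this]
    exact this.choose_spec

variable {G : Type*} [Group G] [Countable G] {γ : ℕ → G}

/-- Along a maximal sofic approximation every observable of every sofic action is approximated: it
is so for a universal action, and the approximable laws are closed. -/
theorem SoficApproximation.IsMaximal.exists_tendsto_profile (hγ : Function.Surjective γ)
    {𝔖 : SoficApproximation G} (h𝔖 : 𝔖.IsMaximal γ) {X : Type*} [MeasurableSpace X]
    [StandardBorelSpace X] [MulAction G X] [MeasurableConstSMul G X] {μ : Measure X}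
    [IsProbabilityMeasure μ] [SMulInvariantMeasure G X μ] (hμ : IsSofic γ μ) {A : Type} [Finite A]
    [MeasurableSpace A] [DiscreteMeasurableSpace A] {f : X → A} (hf : Measurable f) :
    ∃ τ : ∀ i, 𝔖.V i → A, Tendsto (fun i => profile (localStat (𝔖.σ i) (Measure.dirac (τ i))))
      atTop (𝓝 (profile (distr G μ f))) := by
  have : Nonempty X := nonempty_of_isProbabilityMeasure μ
  have : Nonempty A := this.map f
  obtain ⟨S, hS⟩ := exists_soficSystem_distr_eq μ hμ
  obtain ⟨f', hf', hff'⟩ := hS A f hf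
  rw [← hff']
  have : Nonempty (SoficSystem γ) := ⟨S⟩
  obtain ⟨U, hU⟩ := exists_isUniversalSofic (γ := γ) hγ
  have happr := h𝔖 U.Y U.ν hU
  have hwc := hU.2 S.Y S.ν S.isSofic A f' hf'
  have := isProbabilityMeasure_distr (G := G) S.ν hf'
  choose F hF hFlt using fun q : ℕ => hwc ((q : ℝ≥0∞) + 1)⁻¹ (by simp)
  have hlim : Tendsto (fun q => profile (distr G U.ν (F q))) atTop
      (𝓝 (profile (distr G S.ν f'))) := by
    refine tendsto_profile_of_kantorovich hγ (tendsto_of_tendsto_of_tendsto_of_le_of_le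
      tendsto_const_nhds ?_ (fun _ => zero_le) fun q => (hFlt q).le)
    have := (tendsto_add_atTop_iff_nat 1).2 ENNReal.tendsto_inv_nat_nhds_zero
    simpa using this
  obtain ⟨O, hO⟩ := (𝓝 (profile (distr G S.ν f'))).exists_antitone_basis
  obtain ⟨τ, n, hn, hτ⟩ := exists_diagonal (T := fun i => 𝔖.V i → A)
    (fun N i τ => profile (localStat (𝔖.σ i) (Measure.dirac τ)) ∈ O N) fun N => by
      obtain ⟨q, hq⟩ := (hlim.eventually (interior_mem_nhds.2 (hO.mem N))).exists
      obtain ⟨τ, hτ⟩ := happr A (F q) (hF q)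
      have := isProbabilityMeasure_distr (G := G) U.ν (hF q)
      exact ((tendsto_profile_of_kantorovich hγ hτ).eventually
        (mem_interior_iff_mem_nhds.1 hq)).mono fun i hi => ⟨τ i, hi⟩
  refine ⟨τ, hO.1.tendsto_right_iff.2 fun N _ => ?_⟩
  filter_upwards [hτ, hn.eventually_ge_atTop N] with i hi hNi
  exact hO.antitone hNi hi

end Maximal

/-! ### Mixtures of labellings and self-products -/

section SelfProduct

variable {G : Type*} {A V I : Type*} [MeasurableSpace A]

lemma measurable_zip : Measurable fun (p : (I → A) × (I → A)) (i : I) => (p.1 i, p.2 i) :=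
  measurable_pi_lambda _ fun i => ((measurable_pi_apply i).comp measurable_fst).prodMk
    ((measurable_pi_apply i).comp measurable_snd)

lemma selfProd_map {K : Type*} [MeasurableSpace K] (π : Measure K) [IsProbabilityMeasure π]
    {x : K → I → A} (hx : Measurable x) :
    selfProd (π.map x) = (π.prod π).map fun z i => (x z.1 i, x z.2 i) := by
  rw [selfProd, Measure.map_prod_map _ _ hx hx, Measure.map_map measurable_zip (hx.prodMap hx)]
  rfl

variable [DiscreteMeasurableSpace A] [Finite A]

instance isProbabilityMeasure_selfProd (η : Measure (I → A)) [IsProbabilityMeasure η] :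
    IsProbabilityMeasure (selfProd η) :=
  Measure.isProbabilityMeasure_map measurable_zip.aemeasurable

lemma profile_selfProd (m : Measure (G → A)) [IsProbabilityMeasure m] (c : Pattern G (A × A)) :
    profile (selfProd m) c =
      profile m ⟨c.1, fun g => (c.2 g).1⟩ * profile m ⟨c.1, fun g => (c.2 g).2⟩ := by
  simp only [profile]
  rw [measureReal_def, selfProd, Measure.map_apply measurable_zip (measurableSet_patternSet c),
    ← measureReal_def, ← measureReal_prod_prod]
  congr 1
  ext p
  simp [patternSet, Prod.ext_iff, forall_and]

/-- The statistics of a random labelling are the average of the statistics of its values. -/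
lemma profile_localStat_map [Fintype V] {K : Type*} [Fintype K] [MeasurableSpace K]
    [DiscreteMeasurableSpace K] (σ : G → Equiv.Perm V) (π : Measure K) [IsProbabilityMeasure π]
    (x : K → V → A) (c : Pattern G A) :
    profile (localStat σ (π.map x)) c =
      ∑ z, π.real {z} * profile (localStat σ (Measure.dirac (x z))) c := by
  classical
  have hx : Measurable x := Measurable.of_discrete
  have := Measure.isProbabilityMeasure_map (μ := π) hx.aemeasurable
  have hm : ∀ v, MeasurableSet {τ : V → A | ∀ g : c.1, τ (σ g v) = c.2 g} := fun v =>
    (Set.toFinite _).measurableSet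
  have key : ∀ S : Set (V → A), MeasurableSet S →
      (π.map x).real S = ∑ z, π.real {z} * (Measure.dirac (x z)).real S := by
    intro S hS
    have hS' : x ⁻¹' S = (Finset.univ.filter fun z => x z ∈ S : Finset K) := by ext; simp
    rw [measureReal_def, Measure.map_apply hx hS, ← measureReal_def, hS',
      ← sum_measureReal_singleton, Finset.sum_filter]
    refine Finset.sum_congr rfl fun z _ => ?_
    by_cases hz : x z ∈ S <;> simp [measureReal_def, Measure.dirac_apply' _ hS, hz]
  simp only [profile_localStat, key _ (hm _)]
  rw [Finset.sum_comm, Finset.mul_sum]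
  refine Finset.sum_congr rfl fun z _ => ?_
  rw [← Finset.mul_sum]
  ring

end SelfProduct

section Pairs

variable {G : Type*} [Group G] {X A : Type*} [MeasurableSpace X] [MulAction G X]
  [MeasurableConstSMul G X] {μ : Measure X} [IsProbabilityMeasure μ] [MeasurableSpace A]
  [DiscreteMeasurableSpace A] [Finite A]

/-- In the infinite power of an action, an observable read at two different coordinates gives an
independent pair. -/
lemma profile_distr_pair {f : X → A} (hf : Measurable f) {k l : ℕ} (hkl : k ≠ l) :
    profile (distr G (Measure.infinitePi fun _ : ℕ => μ) fun x => (f (x k), f (x l))) =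
      profile (selfProd (distr G μ f)) := by
  have := isProbabilityMeasure_distr (G := G) μ hf
  funext c
  have hs : Function.Injective fun b : Bool => cond b k l := by
    rintro (_ | _) (_ | _) h <;> simp_all [eq_comm]
  have hm : Measurable fun x : ℕ → X => (f (x k), f (x l)) :=
    (hf.comp (measurable_pi_apply k)).prodMk (hf.comp (measurable_pi_apply l))
  have hm' : Measurable fun (x : ℕ → X) (b : Bool) => f (x (cond b k l)) :=
    measurable_pi_lambda _ fun b => hf.comp (measurable_pi_apply _)
  have h := profile_distr_infinitePi (G := G) (fun _ : ℕ => μ) hs (h := fun _ => f) (fun _ => hf)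
    ⟨c.1, fun g b => cond b (c.2 g).1 (c.2 g).2⟩
  rw [Fintype.prod_bool, profile_distr _ hm'] at h
  rw [profile_selfProd, profile_distr _ hm]
  refine Eq.trans ?_ h
  congr 1
  ext x
  simp [funext_iff, Prod.ext_iff, and_comm]

end Pairs

/-! ### Doubly-quenched approximations -/

section DoublyQuenched

lemma profile_mem_Icc {G A : Type*} [MeasurableSpace A] (m : Measure (G → A))
    [IsProbabilityMeasure m] (c : Pattern G A) : profile m c ∈ Set.Icc (0 : ℝ) 1 :=
  ⟨measureReal_nonneg, measureReal_le_one⟩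

/-- The uniform distribution on `n + 1` points. -/
noncomputable def unif (n : ℕ) : Measure (Fin (n + 1)) := ProbabilityTheory.uniformOn Set.univ

instance isProbabilityMeasure_unif (n : ℕ) : IsProbabilityMeasure (unif n) :=
  ProbabilityTheory.isProbabilityMeasure_uniformOn Set.finite_univ Set.univ_nonempty

lemma unif_prod_diagonal (n : ℕ) :
    (unif n).prod (unif n) (Set.diagonal (Fin (n + 1))) = ((n : ℝ≥0∞) + 1)⁻¹ := by
  have h1 : ∀ k, unif n {k} = ((n : ℝ≥0∞) + 1)⁻¹ := fun k => by
    rw [unif, ProbabilityTheory.uniformOn_univ]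
    simp
  rw [Measure.prod_apply MeasurableSet.of_discrete]
  have h2 : ∀ k : Fin (n + 1), Prod.mk k ⁻¹' Set.diagonal (Fin (n + 1)) = {k} := fun k => by
    ext l; simp [eq_comm]
  simp [h2, h1]

variable {G : Type*} [Group G] [Countable G] {γ : ℕ → G}

/-- For an observable `f`, labellings that approximate `n + 1` independent copies of `f` are mixed
uniformly. A pair drawn from the mixture is off the diagonal with probability `1 - 1 / (n + 1)`, and
then it approximates the independent pair. -/
theorem isStronglySofic_of_isMaximal (hγ : Function.Surjective γ) {𝔖 : SoficApproximation G}
    (h𝔖 : 𝔖.IsMaximal γ) {X : Type*} [MeasurableSpace X] [StandardBorelSpace X] [MulAction G X]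
    [MeasurableConstSMul G X] {μ : Measure X} [IsProbabilityMeasure μ]
    [SMulInvariantMeasure G X μ] (hμ : IsSofic γ μ) : IsStronglySofic γ 𝔖 μ := by
  intro A _ _ _ f hf
  have : Nonempty X := nonempty_of_isProbabilityMeasure μ
  have : Nonempty A := this.map f
  have := isProbabilityMeasure_distr (G := G) μ hf
  set t : Pattern G (A × A) → ℝ := profile (selfProd (distr G μ f)) with ht
  -- labellings that approximate `n + 1` independent copies of the observable
  have hpow : IsSofic γ (Measure.infinitePi fun _ : ℕ => μ) := isSofic_infinitePi hγ fun _ => hμ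
  have hcopies : ∀ n, Measurable fun (x : ℕ → X) (k : Fin (n + 1)) => f (x k) := fun n =>
    measurable_pi_lambda _ fun k => hf.comp (measurable_pi_apply _)
  choose τ hτ using fun n => h𝔖.exists_tendsto_profile hγ hpow (hcopies n)
  set L : ∀ n, Fin (n + 1) × Fin (n + 1) → Pattern G (A × A) → ℝ := fun n z =>
    profile (distr G (Measure.infinitePi fun _ : ℕ => μ) fun x => (f (x z.1), f (x z.2))) with hL
  set ξ : ∀ n i, Fin (n + 1) × Fin (n + 1) → 𝔖.V i → A × A :=
    fun n i z v => (τ n i v z.1, τ n i v z.2) with hξ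
  have hpair : ∀ n z, Tendsto (fun i => profile (localStat (𝔖.σ i) (Measure.dirac (ξ n i z))))
      atTop (𝓝 (L n z)) := by
    intro n z
    have := isProbabilityMeasure_distr (G := G) (Measure.infinitePi fun _ : ℕ => μ) (hcopies n)
    have h := tendsto_profile_map (fun b : Fin (n + 1) → A => (b z.1, b z.2)) (hτ n)
    simp only [map_localStat_dirac, map_distr _ (hcopies n)] at h
    exact h
  have hoff : ∀ n (z : Fin (n + 1) × Fin (n + 1)), z.1 ≠ z.2 → L n z = t := fun n z hz =>
    profile_distr_pair hf fun h => hz (Fin.ext h)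
  set π : ∀ n, Measure (Fin (n + 1) × Fin (n + 1)) := fun n => (unif n).prod (unif n) with hπ
  set η : ∀ n i, Measure (𝔖.V i → A) := fun n i => (unif n).map fun k v => τ n i v k with hη
  have hηp : ∀ n i, IsProbabilityMeasure (η n i) := fun n i =>
    Measure.isProbabilityMeasure_map (Measurable.of_discrete).aemeasurable
  have hself : ∀ n i, selfProd (η n i) = (π n).map (ξ n i) := fun n i =>
    selfProd_map (unif n) Measurable.of_discrete
  -- the limit of the statistics of the squares, for a fixed number of copies
  set M : ℕ → Pattern G (A × A) → ℝ := fun n c => ∑ z, (π n).real {z} * L n z c with hM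
  have hMlim : ∀ n, Tendsto (fun i => profile (localStat (𝔖.σ i) (selfProd (η n i)))) atTop
      (𝓝 (M n)) := by
    intro n
    refine tendsto_pi_nhds.2 fun c => ?_
    simp only [hself, profile_localStat_map]
    exact tendsto_finsetSum _ fun z _ => (tendsto_pi_nhds.1 (hpair n z) c).const_mul _
  have hMt : Tendsto M atTop (𝓝 t) := by
    refine tendsto_pi_nhds.2 fun c => tendsto_iff_dist_tendsto_zero.2 ?_
    -- only the diagonal terms differ from the target, each by at most `1`
    refine squeeze_zero (fun _ => dist_nonneg) (fun n => ?_) tendsto_one_div_add_atTop_nhds_zero_nat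
    have hone : ∑ z, (π n).real {z} = 1 := by
      rw [sum_measureReal_singleton]; simp
    have hdiff : M n c - t c = ∑ z, (π n).real {z} * (L n z c - t c) := by
      simp only [hM, mul_sub, Finset.sum_sub_distrib, ← Finset.sum_mul, hone, one_mul]
    have hbd : ∀ z, |(π n).real {z} * (L n z c - t c)| ≤
        if z.1 = z.2 then (π n).real {z} else 0 := by
      intro z
      split_ifs with hz
      · have hm : Measurable fun x : ℕ → X => (f (x z.1), f (x z.2)) :=
          (hf.comp (measurable_pi_apply _)).prodMk (hf.comp (measurable_pi_apply _))
        have := isProbabilityMeasure_distr (G := G) (Measure.infinitePi fun _ : ℕ => μ) hm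
        have h1 : L n z c ∈ Set.Icc (0 : ℝ) 1 := profile_mem_Icc _ c
        have h2 : t c ∈ Set.Icc (0 : ℝ) 1 := profile_mem_Icc _ c
        rw [abs_mul, abs_of_nonneg measureReal_nonneg]
        refine mul_le_of_le_one_right measureReal_nonneg (abs_le.2 ⟨?_, ?_⟩) <;>
          linarith [h1.1, h1.2, h2.1, h2.2]
      · simp [hoff n z hz]
    rw [Real.dist_eq, hdiff]
    refine (Finset.abs_sum_le_sum_abs _ _).trans ((Finset.sum_le_sum fun z _ => hbd z).trans ?_)
    rw [← Finset.sum_filter, sum_measureReal_singleton]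
    have hset : ((Finset.univ.filter fun z : Fin (n + 1) × Fin (n + 1) => z.1 = z.2 : Finset _) :
        Set (Fin (n + 1) × Fin (n + 1))) = Set.diagonal _ := by ext z; simp
    rw [hset, measureReal_def, hπ, unif_prod_diagonal]
    simp [ENNReal.toReal_inv, ENNReal.toReal_add]
  have hoffπ : ∀ n : ℕ, 1 - ((n : ℝ≥0∞) + 1)⁻¹ = π n (Set.diagonal (Fin (n + 1)))ᶜ := fun n => by
    rw [prob_compl_eq_one_sub MeasurableSet.of_discrete, hπ, unif_prod_diagonal]
  set good : ∀ i, ℝ≥0∞ → Set (𝔖.V i → A × A) := fun i ε => {x | kantorovich (shiftDist γ)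
    (localStat (𝔖.σ i) (Measure.dirac x)) (selfProd (distr G μ f)) < ε} with hgood
  have hgoodlim : ∀ (n : ℕ) (ε : ℝ≥0∞), 0 < ε → ∀ᶠ i in atTop,
      1 - ((n : ℝ≥0∞) + 1)⁻¹ ≤ selfProd (η n i) (good i ε) := by
    intro n ε hε
    have hall : ∀ᶠ i in atTop, ∀ z : Fin (n + 1) × Fin (n + 1), z.1 ≠ z.2 →
        ξ n i z ∈ good i ε := by
      refine eventually_all.2 fun z => ?_
      by_cases hz : z.1 = z.2
      · exact Eventually.of_forall fun i h => absurd hz h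
      · have hlim := hpair n z
        rw [hoff n z hz] at hlim
        exact ((tendsto_kantorovich_of_profile γ hlim).eventually_lt_const hε).mono
          fun i hi _ => hi
    filter_upwards [hall] with i hi
    rw [hoffπ, hself, Measure.map_apply Measurable.of_discrete (Set.toFinite _).measurableSet]
    exact measure_mono fun z hz => hi z hz
  -- let the number of copies grow slowly
  obtain ⟨O, hO⟩ := (𝓝 t).exists_antitone_basis
  have hne : ∀ i, Nonempty (ProbabilityMeasure (𝔖.V i → A)) := fun i =>
    ⟨⟨Measure.dirac fun _ => Classical.arbitrary A, inferInstance⟩⟩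
  obtain ⟨ζ, n, hn, hζ⟩ := exists_diagonal (T := fun i => ProbabilityMeasure (𝔖.V i → A))
    (fun N i ζ => profile (localStat (𝔖.σ i) (selfProd (ζ : Measure (𝔖.V i → A)))) ∈ O N ∧
      1 - ((N : ℝ≥0∞) + 1)⁻¹ ≤
        selfProd (ζ : Measure (𝔖.V i → A)) (good i ((N : ℝ≥0∞) + 1)⁻¹)) fun N => by
      obtain ⟨n, hnO, hNn⟩ := ((hMt.eventually (interior_mem_nhds.2 (hO.mem N))).and
        (eventually_ge_atTop N)).exists
      filter_upwards [(hMlim n).eventually (mem_interior_iff_mem_nhds.1 hnO),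
        hgoodlim n ((N : ℝ≥0∞) + 1)⁻¹ (by simp)] with i h1 h2
      refine ⟨⟨η n i, hηp n i⟩, h1, le_trans ?_ h2⟩
      gcongr
  have hinv : Tendsto (fun i => ((n i : ℝ≥0∞) + 1)⁻¹) atTop (𝓝 0) := by
    have := (tendsto_add_atTop_iff_nat 1).2 ENNReal.tendsto_inv_nat_nhds_zero
    simp only [Nat.cast_add, Nat.cast_one] at this
    exact this.comp hn
  refine ⟨fun i => ζ i, fun i => inferInstance, ?_, fun ε hε => ?_⟩
  · refine tendsto_kantorovich_of_profile γ (hO.1.tendsto_right_iff.2 fun N _ => ?_)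
    filter_upwards [hζ, hn.eventually_ge_atTop N] with i hi hNi
    exact hO.antitone hNi hi.1
  · refine tendsto_of_tendsto_of_tendsto_of_le_of_le' (g := fun i => 1 - ((n i : ℝ≥0∞) + 1)⁻¹)
      (by simpa using ENNReal.Tendsto.sub tendsto_const_nhds hinv (Or.inl ENNReal.one_ne_top))
      tendsto_const_nhds ?_ (Eventually.of_forall fun i => prob_le_one)
    filter_upwards [hζ, hinv.eventually_lt_const hε] with i hi hlt
    exact hi.2.trans (measure_mono fun x hx => lt_trans hx hlt)

end DoublyQuenched

end SoficAction

theorem mainTheorem4 {G : Type*} [Group G] [Countable G]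
    (γ : ℕ → G) (hγ : Function.Surjective γ)
    (𝔖 : SoficAction.SoficApproximation G) (h𝔖 : 𝔖.IsMaximal γ)
    {X : Type*} [MeasurableSpace X] [StandardBorelSpace X] [MulAction G X]
    [MeasurableConstSMul G X] (μ : Measure X) [IsProbabilityMeasure μ]
    [SMulInvariantMeasure G X μ] (hμ : SoficAction.IsSofic γ μ) :
    SoficAction.IsStronglySofic γ 𝔖 μ :=
  SoficAction.isStronglySofic_of_isMaximal hγ h𝔖 hμ
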